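/- **Setting.** Let $P\subseteq\mathbb R^d$ be a polyhedron, i.e. a non-empty intersection of finitely many closed half-spaces. Its support function is $h_P(\mathbf v)=-\min_{\mathbf y\in P}\langle \mathbf v,\mathbf y\rangle\in\mathbb R\cup\{\infty\}$ (with value $\infty$ if $\langle\mathbf v,\cdot\rangle$ is unbounded below on $P$), and its normal fan $\mathcal N(P)$ consists of the cones $C_F=\{\mathbf v : h_P(\mathbf v)=-\langle \mathbf v,\mathbf y\rangle\neq\infty \text{ for all }\mathbf y\in F\}$ for the non-empty faces $F$ of $P$. Call $P$ *non-codegenerate* if $\mathbf 0$ is not in the affine span of any facet of $P$. For $P$ full-dimensional and non-codegenerate, choose a generator $\mathbf v_i$ of each ray of $\mathcal N(P)$ and a triangulation $\mathcal T$ of $\mathcal N(P)$ into full-dimensional simplicial cones spanned by these generators. The *dual volume* of $P$ is $$\mathrm{Vol}^\vee(P)=\sum_{C=\mathrm{span}_{\ge 0}(\mathbf v_{j_1},\dots,\mathbf v_{j_d})\in\mathcal T}\frac{|\det(\mathbf v_{j_1},\dots,\mathbf v_{j_d})|}{h_P(\mathbf v_{j_1})\cdots h_P(\mathbf v_{j_d})},$$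 where the value is $0$ if the maximal cones of $\mathcal N(P)$ have dimension less than $d$. Put $\mathrm{Vol}^\vee(P)=0$ if $P$ is not full-dimensional. The *dual volume function* is $\mathrm{Vol}^\vee_{\mathbf z}(P)=\mathrm{Vol}^\vee(P-\mathbf z)$. For $\mathbf z\in\mathbb R^d$ let $I_P(\mathbf z)=\int_{\mathbb R^d}\exp(-h_P(\mathbf v)-\langle \mathbf v,\mathbf z\rangle)\,d\mathbf v\in[0,\infty]$ (with $e^{-\infty}=0$). The *regularized value* of this integral at $\mathbf z$ is the value at $\mathbf z$ of the rational function of $\mathbf w$ which equals $I_P(\mathbf w)$ for all $\mathbf w$ with $I_P(\mathbf w)<\infty$ (for it to exist these $\mathbf w$ must form a set with non-empty interior, and the rational function must have a representation $N/D$ with $D$ non-zero at all of these $\mathbf w$ and at $\mathbf z$); if $I_P(\mathbf w)=\infty$ for all $\mathbf w$, the regularized value is $0$ by convention. The regularized value is unique if it exists. **Theorem.** Let $P\subseteq\mathbb R^d$ be a polyhedron. 1. For every $\mathbf z\in\mathbb R^d$ such that $P-\mathbf z$ is non-codegenerate, $$\mathrm{Vol}^\vee_{\mathbf z}(P)=\int_{\mathbb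 R^d}\exp(-h_P(\mathbf v)-\langle \mathbf v,\mathbf z\rangle)\,d\mathbf v ,$$ where the right-hand side is the regularized value of the integral, which exists. If the integral converges, the equation holds with the ordinary Lebesgue integral. 2. If $\mathbf z$ is in the interior of $P$, then $P-\mathbf z$ is non-codegenerate and the integral converges. 3. In particular, if $P$ is non-codegenerate, then $$\mathrm{Vol}^\vee(P)=\int_{\mathbb R^d}e^{-h_P(\mathbf v)}\,d\mathbf v ,$$ where the right-hand side is the regularized value of the integral at $\mathbf z=\mathbf 0$, and the ordinary integral if it converges. -/

import Mathlib

open MeasureTheory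
open scoped ENNReal RealInnerProductSpace

noncomputable section

namespace DualVol

/-- Euclidean space of dimension `d`. -/
abbrev E (d : ℕ) : Type := EuclideanSpace ℝ (Fin d)

variable {d : ℕ}

/-! ### Polyhedra, faces, support function, normal fan -/

/-- A polyhedron: a nonempty intersection of finitely many closed half-spaces. -/
def IsPolyhedron (P : Set (E d)) : Prop :=
  P.Nonempty ∧
    ∃ (m : ℕ) (a : Fin m → E d) (b : Fin m → ℝ), P = {x | ∀ i, ⟪a i, x⟫ ≤ b i}

/-- A (nonempty) face of `P`: the set of all points of `P` where some linear functional attains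
its maximum over `P`. -/
def IsFace (P F : Set (E d)) : Prop := IsExposed ℝ P F ∧ F.Nonempty

/-- A facet of `P`: a face of dimension `dim P - 1`. -/
def IsFacet (P F : Set (E d)) : Prop :=
  IsFace P F ∧
    Module.finrank ℝ (vectorSpan ℝ F) + 1 = Module.finrank ℝ (vectorSpan ℝ P)

/-- `P` is non-codegenerate: the origin is not in the affine span of any facet of `P`. -/
def NonCodegenerate (P : Set (E d)) : Prop :=
  ∀ F, IsFacet P F → (0 : E d) ∉ affineSpan ℝ F

/-- The support function `h_P(v) = - min_{y ∈ P} ⟪v, y⟫`, with value `⊤` where `⟪v, ·⟫` is not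
bounded below on `P`. -/
def supportFun (P : Set (E d)) (v : E d) : EReal :=
  ⨆ y ∈ P, ((-⟪v, y⟫ : ℝ) : EReal)

/-- The normal cone `C_F = {v | h_P(v) = -⟪v, y⟫ for all y ∈ F}` (so `h_P` is finite on `C_F`
when `F` is nonempty). -/
def normalCone (P F : Set (E d)) : Set (E d) :=
  {v | ∀ y ∈ F, supportFun P v = ((-⟪v, y⟫ : ℝ) : EReal)}

/-- The normal fan of `P`: the set of the cones `C_F`, for `F` a face of `P`. -/
def normalFan (P : Set (E d)) : Set (Set (E d)) :=
  {C | ∃ F, IsFace P F ∧ C = normalCone P F}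

/-- The translate `P - z`. -/
def translate (P : Set (E d)) (z : E d) : Set (E d) := (fun x => x - z) '' P

/-! ### Triangulations of fans and the dual volume -/

/-- A set of cones is pure of dimension `r` if all its maximal members have dimension `r`. -/
def IsPureOfDim (𝓕 : Set (Set (E d))) (r : ℕ) : Prop :=
  ∀ C, Maximal (· ∈ 𝓕) C → Module.finrank ℝ (Submodule.span ℝ C) = r

/-- The ray spanned by `v`. -/
def ray (v : E d) : Set (E d) := {x | ∃ t : ℝ, 0 ≤ t ∧ x = t • v}

/-- The cone spanned by the vectors `gen i`, `i ∈ s`. -/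
def simplexCone {g : ℕ} (gen : Fin g → E d) (s : Finset (Fin g)) : Set (E d) :=
  {x | ∃ c : Fin g → ℝ, (∀ i, 0 ≤ c i) ∧ x = ∑ i ∈ s, c i • gen i}

/-- A choice of one generator for every ray of `𝓕`, and a triangulation of `𝓕` into
full-dimensional simplicial cones spanned by these generators. A set `s = {j₁ < ⋯ < j_d}` in
`simplices` stands for the cone spanned by `gen j₁, …, gen j_d`. -/
structure FanTriangulation (𝓕 : Set (Set (E d))) where
  /-- the number of rays -/
  g : ℕ
  /-- the chosen generators of the rays -/
  gen : Fin g → E d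
  gen_ne_zero : ∀ i, gen i ≠ 0
  gen_ray : ∀ i, ray (gen i) ∈ 𝓕
  gen_unique : ∀ v : E d, v ≠ 0 → ray v ∈ 𝓕 → ∃! i, ray (gen i) = ray v
  /-- the maximal cones of the triangulation -/
  simplices : Finset (Finset (Fin g))
  card_eq : ∀ s ∈ simplices, s.card = d
  linearIndependent : ∀ s ∈ simplices, LinearIndependent ℝ (fun i : s => gen i)
  subordinate : ∀ s ∈ simplices, ∃ C ∈ 𝓕, simplexCone gen s ⊆ C
  covers : (⋃ s ∈ simplices, simplexCone gen s) = ⋃₀ 𝓕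
  inter_eq : ∀ s ∈ simplices, ∀ t ∈ simplices,
    simplexCone gen s ∩ simplexCone gen t = simplexCone gen (s ∩ t)

/-- `|det(gen j₁, …, gen j_d)|` for `s = {j₁ < ⋯ < j_d}`. -/
def absDet {g : ℕ} (gen : Fin g → E d) (s : Finset (Fin g)) (hs : s.card = d) : ℝ :=
  |Matrix.det (Matrix.of fun i j : Fin d => gen (s.orderEmbOfFin hs i) j)|

/-- The sum over the cones of a triangulation of
`|det(v_{j₁}, …, v_{j_d})| / (h(v_{j₁}) ⋯ h(v_{j_d}))`. -/
def FanTriangulation.sum {𝓕 : Set (Set (E d))} (T : FanTriangulation 𝓕) (h : E d → ℝ) : ℝ :=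
  ∑ s : T.simplices,
    absDet T.gen s.1 (T.card_eq s.1 s.2) / ∏ i ∈ s.1, h (T.gen i)

open Classical in
/-- `f_𝓕(h)`: the above sum for any triangulation of `𝓕` if `𝓕` is pure of dimension `d`, and
`0` if `𝓕` is pure of lower dimension. -/
def fanDualVolume (𝓕 : Set (Set (E d))) (h : E d → ℝ) : ℝ :=
  if hT : IsPureOfDim 𝓕 d ∧ Nonempty (FanTriangulation 𝓕) then
    (Classical.choice hT.2).sum h
  else 0

open Classical in
/-- The dual volume `Vol^∨(P)`. -/
def dualVolume (P : Set (E d)) : ℝ :=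
  if affineSpan ℝ P = ⊤ then
    fanDualVolume (normalFan P) (fun v => (supportFun P v).toReal)
  else 0

/-- The dual volume function `Vol^∨_z(P) = Vol^∨(P - z)`. -/
def dualVolumeAt (P : Set (E d)) (z : E d) : ℝ := dualVolume (translate P z)

/-! ### The exponential integral and its regularization -/

/-- `∫ exp(-h_P(v) - ⟪v, z⟫) dv`, the Lebesgue integral of a nonnegative function, with values
in `[0, ∞]`. The integrand is `0` where `h_P(v) = ∞`. -/
def expIntegral (P : Set (E d)) (z : E d) : ℝ≥0∞ :=
  ∫⁻ v : E d, EReal.exp (-supportFun P v - ((⟪v, z⟫ : ℝ) : EReal))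

/-- The set of all `z` for which the integral converges. -/
def convergenceSet (P : Set (E d)) : Set (E d) := {z | expIntegral P z ≠ ∞}

/-- `x` is the value at `z` of the function `w ↦ ∫ exp(-h_P(v) - ⟪v, w⟫) dv`, continued from its
set of convergence to a rational function of `w`, which has to be regular at `z`. If the
integral converges for no `w` at all, the value is `0`, by the usual convention for exponential
integrals over cones that contain a line. -/
def HasRegularizedIntegral (P : Set (E d)) (z : E d) (x : ℝ) : Prop :=
  ((interior (convergenceSet P)).Nonempty ∧
    ∃ N D : MvPolynomial (Fin d) ℝ,
      (∀ w ∈ convergenceSet P, MvPolynomial.eval (fun i => w i) D ≠ 0 ∧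
        (expIntegral P w).toReal =
          MvPolynomial.eval (fun i => w i) N / MvPolynomial.eval (fun i => w i) D) ∧
      MvPolynomial.eval (fun i => z i) D ≠ 0 ∧
      x = MvPolynomial.eval (fun i => z i) N / MvPolynomial.eval (fun i => z i) D) ∨
  (convergenceSet P = ∅ ∧ x = 0)

/-- The regularized value is unique. -/
theorem HasRegularizedIntegral.unique {P : Set (E d)} {z : E d} {x y : ℝ}
    (hx : HasRegularizedIntegral P z x) (hy : HasRegularizedIntegral P z y) : x = y := by
  rcases hx with ⟨hne, N, D, hND, hDz, rfl⟩ | ⟨he, rfl⟩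
  · rcases hy with ⟨-, N', D', hND', hDz', rfl⟩ | ⟨he', rfl⟩
    · have key : N * D' = N' * D := by
        obtain ⟨w₀, hw₀⟩ := hne
        have hopen : IsOpen ((fun w : Fin d → ℝ => (WithLp.toLp 2 w : E d)) ⁻¹'
            interior (convergenceSet P)) :=
          isOpen_interior.preimage (PiLp.continuous_toLp 2 _)
        obtain ⟨ε, hε, hball⟩ := Metric.isOpen_iff.1 hopen (fun i => w₀ i) (by simpa using hw₀)
        refine MvPolynomial.funext_set (fun i => Metric.ball (w₀ i) ε) (fun i => ?_) ?_
        · rw [Real.ball_eq_Ioo]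
          exact Set.Ioo_infinite (by linarith)
        · intro w hw
          have hw' : w ∈ Metric.ball (fun i => w₀ i) ε := by
            rw [ball_pi _ hε]
            exact hw
          have hc : (WithLp.toLp 2 w : E d) ∈ convergenceSet P := interior_subset (hball hw')
          obtain ⟨h1, h2⟩ := hND _ hc
          obtain ⟨h3, h4⟩ := hND' _ hc
          rw [h2, div_eq_div_iff h1 h3] at h4
          simpa using h4
      have := congrArg (MvPolynomial.eval (fun i => z i)) key
      rw [map_mul, map_mul] at this
      rw [div_eq_div_iff hDz hDz']
      exact this
    · rw [he'] at hne
      simp at hne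
  · rcases hy with ⟨hne, -⟩ | ⟨-, rfl⟩
    · rw [he] at hne
      simp at hne
    · rfl

end DualVol

end

noncomputable section

namespace DualVol

variable {d : ℕ}

/-! On a cone where `h_P` is linear, the integrand is the exponential of a linear functional. Over a
simplicial cone with generators `v_1, …, v_d`, a linear change of variables turns its integral into
the absolute determinant times `∏ ∫_0^∞ exp(-a_i t) dt`, where `a_i = h_P(v_i) + ⟪v_i, z⟫`; a factor
is `1 / a_i` if `a_i > 0` and infinite otherwise (`IsBasisSet.setLIntegral_simplexCone`). The `a_i`
are the support values of `P - z`, and translation does not change the normal fan. So, where the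
integral is finite, its sum over a triangulation is the sum defining the dual volume of `P - z`.
This is a rational function of `z` whose denominator is a product of the affine functions `a_i`. For
full-dimensional `P` every ray of the fan belongs to a facet, and `a_i = 0` puts `z` in its affine
span, so non-codegeneracy makes the denominator nonzero (`NonCodegenerate.supportFun_ne_zero`). At
interior points `h_P(v) + ⟪v, z⟫ ≥ ε‖v‖`, hence convergence.

The dual volume is nonzero only if a triangulation exists, so one has to be constructed
(`exists_vertexData`). The normals of an irredundant system generate exactly the rays of the fan.
After a small generic change of the right-hand sides, every vertex lies on exactly `d` of the
hyperplanes, whose normals span a simplicial cone. Complementary slackness shows that these cones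
meet in common faces; the simplex method shows that they cover. Smallness makes them subordinate to
the original fan.

Two degenerate cases remain. If `P` is not full-dimensional, the integrand scales exponentially
along a direction orthogonal to `P`, so each integral is zero or infinite. If `P` contains a line,
`h_P` is infinite almost everywhere and there is no triangulation, so both sides vanish. -/

/-- The solution set of the system of linear inequalities `-h i ≤ ⟪V i, x⟫`. -/
def solutionSet {g : ℕ} (V : Fin g → E d) (h : Fin g → ℝ) : Set (E d) :=
  {x | ∀ i, -h i ≤ ⟪V i, x⟫}

/-- No inequality of the system `-h i ≤ ⟪V i, x⟫` follows from the others. -/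
def IsIrredundant {g : ℕ} (V : Fin g → E d) (h : Fin g → ℝ) : Prop :=
  ∀ i, ∃ x, ⟪V i, x⟫ < -h i ∧ ∀ j, j ≠ i → -h j ≤ ⟪V j, x⟫

/-- A system with the fewest inequalities will do: one implied by the others could be dropped. -/
theorem IsPolyhedron.exists_solutionSet {P : Set (E d)} (hP : IsPolyhedron P) :
    ∃ (g : ℕ) (V : Fin g → E d) (h : Fin g → ℝ), P = solutionSet V h ∧ IsIrredundant V h := by
  classical
  have hex : ∃ (g : ℕ) (V : Fin g → E d) (h : Fin g → ℝ), P = solutionSet V h := by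
    obtain ⟨-, m, a, b, rfl⟩ := hP
    refine ⟨m, fun i => -a i, b, ?_⟩
    ext x
    simp [solutionSet]
  obtain ⟨V, h, hV⟩ := Nat.find_spec hex
  refine ⟨Nat.find hex, V, h, hV, ?_⟩
  by_contra hcon
  simp only [IsIrredundant, not_forall, not_exists, not_and] at hcon
  obtain ⟨i, hi⟩ := hcon
  have hpos : 0 < Nat.find hex := i.pos
  have hmin := Nat.find_min hex (Nat.sub_one_lt hpos.ne')
  generalize Nat.find hex = g at *
  obtain ⟨k, rfl⟩ : ∃ k, g = k + 1 := ⟨g - 1, by omega⟩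
  refine hmin ⟨V ∘ i.succAbove, h ∘ i.succAbove, ?_⟩
  rw [hV]
  ext x
  simp only [solutionSet, Set.mem_ofPred_eq, Function.comp_apply]
  refine ⟨fun hx j => hx _, fun hx => ?_⟩
  have hne : ∀ j, j ≠ i → -h j ≤ ⟪V j, x⟫ := by
    intro j hj
    obtain ⟨j', rfl⟩ := Fin.exists_succAbove_eq hj
    exact hx j'
  intro j
  by_cases hj : j = i
  · subst hj
    by_contra hlt
    obtain ⟨j', h1, h2⟩ := hi x (not_le.1 hlt)
    exact h2 (hne j' h1)
  · exact hne j hj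

theorem IsPolyhedron.convex {P : Set (E d)} (hP : IsPolyhedron P) : Convex ℝ P := by
  obtain ⟨-, m, a, b, rfl⟩ := hP
  rw [Set.ofPred_forall]
  exact convex_iInter fun i => convex_halfSpace_le (innerₛₗ ℝ (a i)).isLinear (b i)

/-- A linear functional bounded on one side by its value at an interior point vanishes. -/
theorem eq_zero_of_forall_inner_le_of_mem_interior {P : Set (E d)} {x v : E d}
    (hx : x ∈ interior P) (h : ∀ y ∈ P, ⟪v, x⟫ ≤ ⟪v, y⟫) : v = 0 := by
  have hc : Filter.Tendsto (fun t : ℝ => x - t • v) (nhdsWithin 0 (Set.Ioi 0)) (nhds x) := by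
    have : Continuous fun t : ℝ => x - t • v := by fun_prop
    simpa using (this.tendsto 0).mono_left nhdsWithin_le_nhds
  have hev := hc.eventually (mem_interior_iff_mem_nhds.1 hx)
  obtain ⟨t, ht, ht0⟩ := (hev.and self_mem_nhdsWithin).exists
  have := h _ ht
  rw [inner_sub_right, inner_smul_right] at this
  have h2 : t * ⟪v, v⟫ ≤ 0 := by linarith
  have h3 : ⟪v, v⟫ ≤ 0 := by
    by_contra h4
    exact absurd h2 (not_le.2 (mul_pos ht0 (not_le.1 h4)))
  exact inner_self_eq_zero.1 (le_antisymm h3 real_inner_self_nonneg)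

/-! ### Tight inequalities and small moves -/

section System

variable {g : ℕ} {V : Fin g → E d} {h : Fin g → ℝ}

theorem isPolyhedron_solutionSet (hne : (solutionSet V h).Nonempty) :
    IsPolyhedron (solutionSet V h) :=
  ⟨hne, g, fun i => -V i, h, by ext x; simp [solutionSet, neg_le]⟩

theorem IsIrredundant.ne_zero (hV : IsIrredundant V h) (hne : (solutionSet V h).Nonempty)
    (i : Fin g) : V i ≠ 0 := by
  intro h0
  obtain ⟨x, hx, -⟩ := hV i
  obtain ⟨y, hy⟩ := hne
  have := hy i
  rw [h0, inner_zero_left] at this hx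
  linarith

theorem lt_inner_of_mem_interior {x : E d} (hx : x ∈ interior (solutionSet V h)) {i : Fin g}
    (hi : V i ≠ 0) : -h i < ⟪V i, x⟫ := by
  refine lt_of_le_of_ne (interior_subset hx i) fun heq => hi ?_
  exact eq_zero_of_forall_inner_le_of_mem_interior hx fun y hy => heq ▸ hy i

/-- There is a point where exactly one inequality of an irredundant system is an equality. -/
theorem IsIrredundant.exists_tight (hV : IsIrredundant V h) {x₀ : E d}
    (hx₀ : ∀ i, -h i < ⟪V i, x₀⟫) (i : Fin g) :
    ∃ p, ⟪V i, p⟫ = -h i ∧ ∀ j, j ≠ i → -h j < ⟪V j, p⟫ := by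
  obtain ⟨x, hx, hx'⟩ := hV i
  have h0 := hx₀ i
  set a := -h i - ⟪V i, x⟫ with ha
  set b := ⟪V i, x₀⟫ + h i with hb
  have hapos : 0 < a := by linarith
  have hbpos : 0 < b := by linarith
  -- The point of the segment from `x`, which violates inequality `i` by `a`, to `x₀`, which has
  -- slack `b`, where `i` becomes an equality. The positive weight of `x₀` keeps the others strict.
  refine ⟨(b / (a + b)) • x + (a / (a + b)) • x₀, ?_, fun j hj => ?_⟩
  · rw [inner_add_right, inner_smul_right, inner_smul_right]
    have : ⟪V i, x⟫ = -h i - a := by rw [ha]; ring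
    have h2 : ⟪V i, x₀⟫ = b - h i := by rw [hb]; ring
    rw [this, h2]
    field_simp
    ring
  · rw [inner_add_right, inner_smul_right, inner_smul_right]
    have h1 := mul_le_mul_of_nonneg_left (hx' j hj) (a := b / (a + b)) (by positivity)
    have h2 := mul_lt_mul_of_pos_left (hx₀ j) (a := a / (a + b)) (by positivity)
    have h3 : b / (a + b) * -h j + a / (a + b) * -h j = -h j := by
      field_simp
      ring
    linarith

/-- Moving in a direction orthogonal to the inequalities that are equalities at `x`, one stays
in the solution set for a while. -/
theorem exists_add_smul_mem {x u : E d} (hx : x ∈ solutionSet V h)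
    (hu : ∀ i, ⟪V i, x⟫ = -h i → ⟪V i, u⟫ = 0) :
    ∃ ε : ℝ, 0 < ε ∧ x + ε • u ∈ solutionSet V h := by
  have hev : ∀ᶠ ε : ℝ in nhdsWithin 0 (Set.Ioi 0), ∀ i, -h i ≤ ⟪V i, x + ε • u⟫ := by
    rw [Filter.eventually_all]
    intro i
    rcases (hx i).eq_or_lt with heq | hlt
    · refine Filter.Eventually.of_forall fun ε => ?_
      rw [inner_add_right, inner_smul_right, hu i heq.symm, mul_zero, add_zero, heq]
    · have hc : Filter.Tendsto (fun ε : ℝ => ⟪V i, x + ε • u⟫) (nhdsWithin 0 (Set.Ioi 0))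
          (nhds ⟪V i, x⟫) := by
        have : Continuous fun ε : ℝ => ⟪V i, x + ε • u⟫ := by fun_prop
        simpa using (this.tendsto 0).mono_left nhdsWithin_le_nhds
      exact (hc.eventually (lt_mem_nhds hlt)).mono fun ε hε => hε.le
  obtain ⟨ε, h1, h2⟩ := (hev.and self_mem_nhdsWithin).exists
  exact ⟨ε, h2, h1⟩

end System

/-! ### Support function, normal cones and faces -/

theorem supportFun_eq_of_forall_le {P : Set (E d)} {v y : E d} (hy : y ∈ P)
    (hmin : ∀ x ∈ P, ⟪v, y⟫ ≤ ⟪v, x⟫) : supportFun P v = ((-⟪v, y⟫ : ℝ) : EReal) := by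
  refine le_antisymm (iSup₂_le fun x hx => ?_)
    (le_iSup₂ (f := fun (y : E d) (_ : y ∈ P) => ((-⟪v, y⟫ : ℝ) : EReal)) y hy)
  exact EReal.coe_le_coe_iff.2 (neg_le_neg (hmin x hx))

theorem neg_inner_le_supportFun {P : Set (E d)} {v y : E d} (hy : y ∈ P) :
    ((-⟪v, y⟫ : ℝ) : EReal) ≤ supportFun P v :=
  le_iSup₂ (f := fun (y : E d) (_ : y ∈ P) => ((-⟪v, y⟫ : ℝ) : EReal)) y hy

theorem mem_normalCone_iff {P F : Set (E d)} (hF : F ⊆ P) {v : E d} :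
    v ∈ normalCone P F ↔ ∀ y ∈ F, ∀ x ∈ P, ⟪v, y⟫ ≤ ⟪v, x⟫ := by
  refine ⟨fun hv y hy x hx => ?_, fun hv y hy => supportFun_eq_of_forall_le (hF hy) (hv y hy)⟩
  have := (neg_inner_le_supportFun hx).trans (hv y hy).le
  have := EReal.coe_le_coe_iff.1 this
  linarith

/-- Exposed faces maximise a functional. Its Riesz vector is negated, so that faces minimise `v`, as
in the definition of normal cones. -/
theorem isFace_iff {P F : Set (E d)} :
    IsFace P F ↔ F.Nonempty ∧ ∃ v : E d, F = {x ∈ P | ∀ y ∈ P, ⟪v, x⟫ ≤ ⟪v, y⟫} := by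
  constructor
  · rintro ⟨h1, h2⟩
    obtain ⟨l, hl⟩ := h1 h2
    refine ⟨h2, -(InnerProductSpace.toDual ℝ (E d)).symm l, ?_⟩
    rw [hl]
    ext x
    simp [inner_neg_left]
  · rintro ⟨h2, v, hv⟩
    refine ⟨fun _ => ⟨-(innerSL ℝ v), ?_⟩, h2⟩
    rw [hv]
    ext x
    simp

theorem IsFace.subset {P F : Set (E d)} (hF : IsFace P F) : F ⊆ P := hF.1.subset

theorem exists_isFace_setOf {P : Set (E d)} {v y : E d} (hy : y ∈ P)
    (hmin : ∀ x ∈ P, ⟪v, y⟫ ≤ ⟪v, x⟫) :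
    IsFace P {x ∈ P | ∀ y ∈ P, ⟪v, x⟫ ≤ ⟪v, y⟫} :=
  isFace_iff.2 ⟨⟨y, hy, hmin⟩, v, rfl⟩

/-- A face has a point where an inequality is an equality only if it is so on the whole face. -/
theorem IsFace.exists_relative_interior {g : ℕ} {V : Fin g → E d} {h : Fin g → ℝ}
    {F : Set (E d)} (hF : IsFace (solutionSet V h) F) :
    ∃ x ∈ F, ∀ i, ⟪V i, x⟫ = -h i → ∀ y ∈ F, ⟪V i, y⟫ = -h i := by
  classical
  have hconv : Convex ℝ F :=
    hF.1.convex (isPolyhedron_solutionSet (hF.2.mono hF.subset)).convex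
  suffices hs : ∀ s : Finset (Fin g), ∃ x ∈ F, ∀ i ∈ s, ⟪V i, x⟫ = -h i →
      ∀ y ∈ F, ⟪V i, y⟫ = -h i by
    obtain ⟨x, hx, hx'⟩ := hs Finset.univ
    exact ⟨x, hx, fun i => hx' i (Finset.mem_univ i)⟩
  intro s
  induction s using Finset.induction_on with
  | empty =>
    obtain ⟨x, hx⟩ := hF.2
    exact ⟨x, hx, by simp⟩
  | insert a s ha ih =>
    obtain ⟨x, hx, hx'⟩ := ih
    by_cases hall : ∀ y ∈ F, ⟪V a, y⟫ = -h a
    · refine ⟨x, hx, fun i hi => ?_⟩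
      rcases Finset.mem_insert.1 hi with rfl | hi
      · exact fun _ => hall
      · exact hx' i hi
    · push Not at hall
      obtain ⟨z, hz, hzne⟩ := hall
      -- At a midpoint of two feasible points an inequality is tight only if it is tight at both.
      refine ⟨(1 / 2 : ℝ) • x + (1 / 2 : ℝ) • z,
        hconv hx hz (by norm_num) (by norm_num) (by norm_num), fun i hi heq => ?_⟩
      have h1 := hF.subset hx i
      have h2 := hF.subset hz i
      rw [inner_add_right, inner_smul_right, inner_smul_right] at heq
      rcases Finset.mem_insert.1 hi with rfl | hi
      · exact absurd (by linarith) hzne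
      · exact hx' i hi (by linarith)

theorem mem_ray_self (v : E d) : v ∈ ray v := ⟨1, zero_le_one, (one_smul _ _).symm⟩

theorem ray_eq_of_mem {v w : E d} (hw : w ∈ ray v) (hw0 : w ≠ 0) : ray w = ray v := by
  obtain ⟨t, ht, rfl⟩ := hw
  have ht0 : t ≠ 0 := fun h => hw0 (by rw [h, zero_smul])
  ext x
  constructor
  · rintro ⟨r, hr, rfl⟩
    exact ⟨r * t, by positivity, by rw [smul_smul]⟩
  · rintro ⟨r, hr, rfl⟩
    exact ⟨r / t, by positivity, by rw [smul_smul, div_mul_cancel₀ _ ht0]⟩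

/-- The inequalities that are equalities on `F` belong to the normal cone of `F`. -/
theorem mem_normalCone_of_tight {g : ℕ} {V : Fin g → E d} {h : Fin g → ℝ} {F : Set (E d)}
    (hF : F ⊆ solutionSet V h) {i : Fin g} (hi : ∀ y ∈ F, ⟪V i, y⟫ = -h i) :
    V i ∈ normalCone (solutionSet V h) F :=
  (mem_normalCone_iff hF).2 fun y hy _ hx => (hi y hy).symm ▸ hx i

/-- A face whose normal cone is a ray has codimension one. -/
theorem IsFace.vectorSpan_eq {P F : Set (E d)} (hP : IsPolyhedron P) (hF : IsFace P F) {v : E d}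
    (hv : normalCone P F = ray v) : vectorSpan ℝ F = (Submodule.span ℝ {v})ᗮ := by
  obtain ⟨g, V, h, rfl, -⟩ := hP.exists_solutionSet
  obtain ⟨x, hx, hx'⟩ := hF.exists_relative_interior
  have hmin := (mem_normalCone_iff hF.subset).1 (hv ▸ mem_ray_self v)
  apply le_antisymm
  · rw [vectorSpan_def, Submodule.span_le]
    rintro _ ⟨a, ha, b, hb, rfl⟩
    rw [SetLike.mem_coe, Submodule.mem_orthogonal_singleton_iff_inner_right]
    change ⟪v, a - b⟫ = 0
    rw [inner_sub_right]
    have h1 := hmin a ha b (hF.subset hb)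
    have h2 := hmin b hb a (hF.subset ha)
    linarith
  · intro u hu
    rw [Submodule.mem_orthogonal_singleton_iff_inner_right] at hu
    -- The normals tight at the relative interior point `x` lie in the normal cone, so they are
    -- multiples of `v` and orthogonal to `u`.
    obtain ⟨ε, hε, hmem⟩ := exists_add_smul_mem (hF.subset hx) (u := u) fun i hi => by
      have := mem_normalCone_of_tight hF.subset (hx' i hi)
      rw [hv] at this
      obtain ⟨t, -, ht⟩ := this
      rw [ht, inner_smul_left, hu, mul_zero]
    -- The functional `w` cutting out `F` is itself a multiple of `v`, so moving along `u` stays in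
    -- `F`.
    obtain ⟨w, hw⟩ := (isFace_iff.1 hF).2
    have hwv : w ∈ ray v := by
      rw [← hv, mem_normalCone_iff hF.subset]
      intro y hy
      rw [hw] at hy
      exact hy.2
    obtain ⟨t, -, rfl⟩ := hwv
    have hxF : x + ε • u ∈ F := by
      have hx2 := hx
      rw [hw] at hx2 ⊢
      refine ⟨hmem, fun y hy => ?_⟩
      have h3 : ⟪t • v, u⟫ = 0 := by rw [inner_smul_left, hu, mul_zero]
      rw [inner_add_right, inner_smul_right, h3, mul_zero, add_zero]
      exact hx2.2 y hy
    have h4 := vsub_mem_vectorSpan ℝ hxF hx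
    rw [vsub_eq_sub, add_sub_cancel_left] at h4
    have := (vectorSpan ℝ F).smul_mem ε⁻¹ h4
    rwa [smul_smul, inv_mul_cancel₀ hε.ne', one_smul] at this

theorem finrank_orthogonal_span_singleton_add_one {v : E d} (hv : v ≠ 0) :
    Module.finrank ℝ (Submodule.span ℝ {v})ᗮ + 1 = d := by
  have h1 := Submodule.finrank_add_finrank_orthogonal (Submodule.span ℝ {v})
  rw [finrank_span_singleton hv, finrank_euclideanSpace_fin] at h1
  omega

/-- The support function of a non-codegenerate polyhedron does not vanish on the rays of the
normal fan. -/
theorem NonCodegenerate.supportFun_ne_zero {P : Set (E d)} (hnc : NonCodegenerate P)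
    (hP : IsPolyhedron P) (htop : affineSpan ℝ P = ⊤) {v : E d} (hv : v ≠ 0)
    (hray : ray v ∈ normalFan P) : (supportFun P v).toReal ≠ 0 := by
  obtain ⟨F, hF, hFv⟩ := hray
  have hspan := hF.vectorSpan_eq hP hFv.symm
  intro h0
  refine hnc F ⟨hF, ?_⟩ ?_
  · rw [AffineSubspace.vectorSpan_eq_top_of_affineSpan_eq_top ℝ _ _ htop, hspan,
      finrank_orthogonal_span_singleton_add_one hv, finrank_top, finrank_euclideanSpace_fin]
  · obtain ⟨y, hy⟩ := hF.2
    have hvy : supportFun P v = _ := (hFv ▸ mem_ray_self v : v ∈ normalCone P F) y hy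
    rw [hvy, EReal.toReal_coe, neg_eq_zero] at h0
    have hmem : -y ∈ (affineSpan ℝ F).direction := by
      rw [direction_affineSpan, hspan, Submodule.mem_orthogonal_singleton_iff_inner_right,
        inner_neg_right, h0, neg_zero]
    simpa using AffineSubspace.vadd_mem_of_mem_direction hmem (mem_affineSpan ℝ hy)

/-- A polyhedron is non-codegenerate if the origin is an interior point. -/
theorem nonCodegenerate_of_mem_interior {P : Set (E d)} (h0 : (0 : E d) ∈ interior P) :
    NonCodegenerate P := by
  rintro F ⟨hF, hdim⟩ hmem
  obtain ⟨⟨y, hy⟩, w, hw⟩ := isFace_iff.1 hF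
  have hy' := hy
  rw [hw] at hy'
  -- The origin lies in the hyperplane through `y` orthogonal to `w`, so `w` is minimal at the
  -- interior point `0`. This forces `w = 0` and `F = P`, which has the wrong dimension.
  have hle : affineSpan ℝ F ≤ AffineSubspace.mk' y (Submodule.span ℝ {w})ᗮ := by
    rw [affineSpan_le]
    intro x hx
    rw [hw] at hx
    rw [SetLike.mem_coe, AffineSubspace.mem_mk', vsub_eq_sub,
      Submodule.mem_orthogonal_singleton_iff_inner_right, inner_sub_right]
    linarith [hx.2 y hy'.1, hy'.2 x hx.1]
  have h1 := hle hmem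
  rw [AffineSubspace.mem_mk', vsub_eq_sub, Submodule.mem_orthogonal_singleton_iff_inner_right,
    inner_sub_right, inner_zero_right, zero_sub, neg_eq_zero] at h1
  have hw0 : w = 0 := eq_zero_of_forall_inner_le_of_mem_interior h0 fun x hx => by
    rw [inner_zero_right, ← h1]
    exact hy'.2 x hx
  have hFP : F = P := by
    rw [hw, hw0]
    simp
  rw [hFP] at hdim
  omega

/-! ### Translations -/

theorem mem_translate {P : Set (E d)} {z x : E d} : x ∈ translate P z ↔ x + z ∈ P := by
  constructor
  · rintro ⟨y, hy, rfl⟩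
    simpa using hy
  · intro hx
    exact ⟨x + z, hx, by simp⟩

theorem translate_zero (P : Set (E d)) : translate P 0 = P := by
  ext x
  simp [mem_translate]

theorem translate_translate_neg (P : Set (E d)) (z : E d) :
    translate (translate P z) (-z) = P := by
  ext x
  simp [mem_translate]

theorem IsPolyhedron.translate {P : Set (E d)} (hP : IsPolyhedron P) (z : E d) :
    IsPolyhedron (translate P z) := by
  obtain ⟨hne, m, a, b, rfl⟩ := hP
  refine ⟨hne.image _, m, a, fun i => b i - ⟪a i, z⟫, ?_⟩
  ext x
  simp [mem_translate, inner_add_right, le_sub_iff_add_le]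

theorem affineSpan_translate_eq_top {P : Set (E d)} (z : E d) (h : affineSpan ℝ P = ⊤) :
    affineSpan ℝ (translate P z) = ⊤ := by
  have h1 : translate P z = (AffineEquiv.constVAdd ℝ (E d) (-z)) '' P := by
    ext x
    simp [DualVol.translate, sub_eq_neg_add]
  rw [h1]
  exact (AffineEquiv.span_eq_top_iff (AffineEquiv.constVAdd ℝ (E d) (-z))).1 h

theorem affineSpan_translate_eq_top_iff {P : Set (E d)} (z : E d) :
    affineSpan ℝ (translate P z) = ⊤ ↔ affineSpan ℝ P = ⊤ :=
  ⟨fun h => by simpa only [translate_translate_neg] using affineSpan_translate_eq_top (-z) h,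
    affineSpan_translate_eq_top z⟩

theorem supportFun_translate (P : Set (E d)) (z v : E d) :
    supportFun (translate P z) v = supportFun P v + ((⟪v, z⟫ : ℝ) : EReal) := by
  -- One inequality for all `Q` and `z` suffices: the other follows by translating back by `-z`.
  have key : ∀ (Q : Set (E d)) (z : E d),
      supportFun (translate Q z) v ≤ supportFun Q v + ((⟪v, z⟫ : ℝ) : EReal) := by
    intro Q z
    refine iSup₂_le fun x hx => ?_
    have h1 := add_le_add_left (neg_inner_le_supportFun (v := v) (mem_translate.1 hx))
      ((⟪v, z⟫ : ℝ) : EReal)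
    refine le_trans (le_of_eq ?_) h1
    rw [← EReal.coe_add, inner_add_right]
    congr 1
    ring
  refine le_antisymm (key P z) ?_
  have h2 := add_le_add_left (key (translate P z) (-z)) ((⟪v, z⟫ : ℝ) : EReal)
  rw [translate_translate_neg, add_assoc, ← EReal.coe_add, inner_neg_right, neg_add_cancel,
    EReal.coe_zero, add_zero] at h2
  exact h2

theorem normalFan_translate (P : Set (E d)) (z : E d) : normalFan (translate P z) = normalFan P := by
  have key : ∀ (Q : Set (E d)) (z : E d), normalFan Q ⊆ normalFan (translate Q z) := by
    rintro Q z _ ⟨F, hF, rfl⟩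
    obtain ⟨hne, v, hv⟩ := isFace_iff.1 hF
    have hsub : translate F z ⊆ translate Q z := Set.image_mono hF.subset
    refine ⟨translate F z, isFace_iff.2 ⟨hne.image _, v, ?_⟩, ?_⟩
    · ext x
      rw [mem_translate, hv]
      simp only [Set.mem_ofPred_eq, mem_translate]
      refine and_congr_right fun _ => ⟨fun h y hy => ?_, fun h y hy => ?_⟩
      · have := h _ hy
        simpa [inner_add_right] using this
      · have := h (y - z) (by simpa using hy)
        rw [inner_add_right]
        rw [inner_sub_right] at this
        linarith
    · ext u
      rw [mem_normalCone_iff hF.subset, mem_normalCone_iff hsub]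
      refine ⟨fun h y hy x hx => ?_, fun h y hy x hx => ?_⟩
      · have := h _ (mem_translate.1 hy) _ (mem_translate.1 hx)
        simpa [inner_add_right] using this
      · have := h (y - z) ⟨y, hy, rfl⟩ (x - z) ⟨x, hx, rfl⟩
        simpa [inner_sub_right] using this
  refine Set.Subset.antisymm ?_ (key P z)
  have := key (translate P z) (-z)
  rwa [translate_translate_neg] at this

/-! ### Simplicial cones, bases and the simplex method -/

section Cones

variable {g : ℕ} {V : Fin g → E d}

/-- The ratio test of the simplex method. -/
theorem exists_ratio {s : Finset (Fin g)} {c f : Fin g → ℝ} (hc : ∀ i, 0 ≤ c i)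
    (hf : ∃ i ∈ s, 0 < f i) :
    ∃ i ∈ s, 0 < f i ∧ ∀ j ∈ s, 0 ≤ c j - c i / f i * f j := by
  classical
  obtain ⟨i, hi, hmin⟩ := Finset.exists_min_image (s.filter fun i => 0 < f i)
    (fun i => c i / f i) (by
      obtain ⟨i, hi, hfi⟩ := hf
      exact ⟨i, Finset.mem_filter.2 ⟨hi, hfi⟩⟩)
  rw [Finset.mem_filter] at hi
  refine ⟨i, hi.1, hi.2, fun j hj => ?_⟩
  have hq : 0 ≤ c i / f i := div_nonneg (hc i) hi.2.le
  rcases le_or_gt (f j) 0 with hfj | hfj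
  · have := mul_nonpos_of_nonneg_of_nonpos hq hfj
    linarith [hc j]
  · have := hmin j (Finset.mem_filter.2 ⟨hj, hfj⟩)
    rw [le_div_iff₀ hfj] at this
    linarith

/-- `simplexCone` asks for nonnegative coefficients at every index; those outside `s` can be reset
to zero. -/
theorem mem_simplexCone {s : Finset (Fin g)} {x : E d} {c : Fin g → ℝ} (hc : ∀ i ∈ s, 0 ≤ c i)
    (hx : x = ∑ i ∈ s, c i • V i) : x ∈ simplexCone V s := by
  classical
  refine ⟨fun i => if i ∈ s then c i else 0, fun i => ?_, ?_⟩
  · dsimp only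
    split_ifs with hi
    · exact hc i hi
    · exact le_rfl
  · rw [hx]
    exact Finset.sum_congr rfl fun i hi => by simp only [if_pos hi]

theorem simplexCone_mono {s t : Finset (Fin g)} (hst : s ⊆ t) :
    simplexCone V s ⊆ simplexCone V t := by
  classical
  rintro x ⟨c, hc, rfl⟩
  refine mem_simplexCone (c := fun i => if i ∈ s then c i else 0) (fun i _ => ?_) ?_
  · split_ifs
    · exact hc i
    · exact le_rfl
  · rw [← Finset.sum_subset hst]
    · exact Finset.sum_congr rfl fun i hi => by rw [if_pos hi]
    · intro i _ hi
      rw [if_neg hi, zero_smul]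

theorem simplexCone_subset_span (s : Finset (Fin g)) :
    simplexCone V s ⊆ Submodule.span ℝ (V '' (s : Set (Fin g))) := by
  rintro x ⟨c, -, rfl⟩
  exact Submodule.sum_mem _ fun i hi => Submodule.smul_mem _ _
    (Submodule.subset_span ⟨i, hi, rfl⟩)

theorem mem_simplexCone_of_mem {s : Finset (Fin g)} {i : Fin g} (hi : i ∈ s) :
    V i ∈ simplexCone V s := by
  classical
  refine mem_simplexCone (c := Pi.single i 1) (fun j _ => ?_) ?_
  · by_cases h : j = i
    · subst h
      simp
    · simp [h]
  · simp [Pi.single_apply, hi]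

theorem convex_simplexCone (s : Finset (Fin g)) : Convex ℝ (simplexCone V s) := by
  rintro _ ⟨c, hc, rfl⟩ _ ⟨c', hc', rfl⟩ a b ha hb -
  refine ⟨fun i => a * c i + b * c' i, fun i => ?_, ?_⟩
  · have := hc i
    have := hc' i
    positivity
  · rw [Finset.smul_sum, Finset.smul_sum, ← Finset.sum_add_distrib]
    exact Finset.sum_congr rfl fun i _ => by rw [add_smul, mul_smul, mul_smul]

/-- Carathéodory's theorem for cones. -/
theorem exists_linearIndepOn_mem_simplexCone {x : E d} {s : Finset (Fin g)}
    (hx : x ∈ simplexCone V s) :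
    ∃ t ⊆ s, LinearIndepOn ℝ V (t : Set (Fin g)) ∧ x ∈ simplexCone V t := by
  classical
  induction s using Finset.strongInduction with
  | H s ih =>
    by_cases hs : LinearIndepOn ℝ V (s : Set (Fin g))
    · exact ⟨s, subset_rfl, hs, hx⟩
    · rw [linearIndepOn_finset_iff] at hs
      push Not at hs
      obtain ⟨f, hf, i, hi, hfi⟩ := hs
      obtain ⟨f, hf, i, hi, hfi⟩ : ∃ f : Fin g → ℝ, ∑ i ∈ s, f i • V i = 0 ∧
          ∃ i ∈ s, 0 < f i := by
        rcases hfi.lt_or_gt with h | h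
        · exact ⟨-f, by simp [hf], i, hi, by simpa using h⟩
        · exact ⟨f, hf, i, hi, h⟩
      obtain ⟨c, hc, rfl⟩ := hx
      -- Subtract the multiple of the linear relation that cancels coefficient `k` and keeps the
      -- others nonnegative.
      obtain ⟨k, hk, hfk, hrat⟩ := exists_ratio hc ⟨i, hi, hfi⟩
      have hmem : ∑ i ∈ s, c i • V i ∈ simplexCone V (s.erase k) := by
        refine mem_simplexCone (c := fun j => c j - c k / f k * f j)
          (fun j hj => hrat j (Finset.mem_of_mem_erase hj)) ?_
        rw [← Finset.sum_erase_add s _ hk]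
        have h1 : ∑ j ∈ s, (c j - c k / f k * f j) • V j = ∑ j ∈ s, c j • V j := by
          simp only [sub_smul, mul_smul, Finset.sum_sub_distrib, ← Finset.smul_sum, hf,
            smul_zero, sub_zero]
        rw [← Finset.sum_erase_add s _ hk, ← Finset.sum_erase_add s _ hk,
          div_mul_cancel₀ _ hfk.ne', sub_self, zero_smul, add_zero] at h1
        exact h1.symm
      obtain ⟨t, ht, h1, h2⟩ := ih _ (Finset.erase_ssubset hk) hmem
      exact ⟨t, ht.trans (Finset.erase_subset _ _), h1, h2⟩

/-- The vectors `V i`, `i ∈ s`, form a basis. -/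
def IsBasisSet (V : Fin g → E d) (s : Finset (Fin g)) : Prop :=
  s.card = d ∧ LinearIndepOn ℝ V (s : Set (Fin g))

theorem IsBasisSet.span_eq_top {s : Finset (Fin g)} (hs : IsBasisSet V s) :
    Submodule.span ℝ (V '' (s : Set (Fin g))) = ⊤ := by
  have := LinearIndependent.span_eq_top_of_card_eq_finrank' (b := fun i : s => V i) hs.2
    (by rw [Fintype.card_coe, hs.1, finrank_euclideanSpace_fin])
  rw [← this]
  congr 1
  ext x
  simp

theorem IsBasisSet.eq_zero {s : Finset (Fin g)} (hs : IsBasisSet V s) {y : E d}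
    (hy : ∀ i ∈ s, ⟪V i, y⟫ = 0) : y = 0 := by
  have hle : Submodule.span ℝ (V '' (s : Set (Fin g))) ≤ (Submodule.span ℝ {y})ᗮ := by
    rw [Submodule.span_le]
    rintro _ ⟨i, hi, rfl⟩
    exact (Submodule.mem_orthogonal_singleton_iff_inner_left).2 (hy i hi)
  rw [hs.span_eq_top] at hle
  exact inner_self_eq_zero.1
    ((Submodule.mem_orthogonal_singleton_iff_inner_left).1 (hle (Submodule.mem_top (x := y))))

/-- Pairing with the basis is an injective map between spaces of dimension `d`, hence invertible.
Linearity in `h` makes degeneracy of `h` a linear condition. -/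
theorem IsBasisSet.exists_tightPoint {s : Finset (Fin g)} (hs : IsBasisSet V s) :
    ∃ Y : (Fin g → ℝ) →ₗ[ℝ] E d, ∀ h, ∀ i ∈ s, ⟪V i, Y h⟫ = -h i := by
  let A : E d →ₗ[ℝ] (s → ℝ) := LinearMap.pi fun i => innerₛₗ ℝ (V i)
  have hA : Function.Injective A := by
    rw [← LinearMap.ker_eq_bot, LinearMap.ker_eq_bot']
    intro y hy
    exact hs.eq_zero fun i hi => congrFun hy ⟨i, hi⟩
  let e := LinearMap.linearEquivOfInjective A hA (by
    rw [finrank_euclideanSpace_fin, Module.finrank_pi, Fintype.card_coe, hs.1])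
  refine ⟨-(e.symm.toLinearMap ∘ₗ LinearMap.funLeft ℝ ℝ (Subtype.val : s → Fin g)),
    fun h i hi => ?_⟩
  have h1 : A (e.symm (LinearMap.funLeft ℝ ℝ (Subtype.val : s → Fin g) h)) =
      LinearMap.funLeft ℝ ℝ (Subtype.val : s → Fin g) h := e.apply_symm_apply _
  have h2 := congrFun h1 ⟨i, hi⟩
  simp only [A, LinearMap.pi_apply, innerₛₗ_apply_apply, LinearMap.funLeft_apply] at h2
  rw [LinearMap.neg_apply, inner_neg_right, ← h2]
  rfl

open Classical in
/-- The point where the inequalities `-h i ≤ ⟪V i, x⟫`, `i ∈ s`, are equalities, as a linear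
function of `h`, provided that `V i`, `i ∈ s`, is a basis. -/
def tightPoint (V : Fin g → E d) (s : Finset (Fin g)) : (Fin g → ℝ) →ₗ[ℝ] E d :=
  if hs : IsBasisSet V s then hs.exists_tightPoint.choose else 0

theorem IsBasisSet.inner_tightPoint {s : Finset (Fin g)} (hs : IsBasisSet V s) (h : Fin g → ℝ)
    {i : Fin g} (hi : i ∈ s) : ⟪V i, tightPoint V s h⟫ = -h i := by
  rw [tightPoint, dif_pos hs]
  exact hs.exists_tightPoint.choose_spec h i hi

theorem IsBasisSet.inner_sum_tightPoint {s : Finset (Fin g)} (hs : IsBasisSet V s)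
    (h c : Fin g → ℝ) : ⟪∑ i ∈ s, c i • V i, tightPoint V s h⟫ = -∑ i ∈ s, c i * h i := by
  rw [sum_inner, ← Finset.sum_neg_distrib]
  refine Finset.sum_congr rfl fun i hi => ?_
  rw [inner_smul_left, hs.inner_tightPoint h hi]
  simp

theorem IsBasisSet.exists_eq_sum {s : Finset (Fin g)} (hs : IsBasisSet V s) (x : E d) :
    ∃ c : Fin g → ℝ, x = ∑ i ∈ s, c i • V i := by
  classical
  have hx : x ∈ Submodule.span ℝ (V '' (s : Set (Fin g))) := hs.span_eq_top ▸ Submodule.mem_top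
  obtain ⟨c, hc⟩ := (Submodule.mem_span_image_finset_iff_exists_fun ℝ).1 hx
  refine ⟨fun i => if hi : i ∈ s then c ⟨i, hi⟩ else 0, ?_⟩
  rw [← hc, ← Finset.sum_coe_sort s]
  exact Finset.sum_congr rfl fun i _ => by simp

/-- The tight points for `-Pi.single i 1` form the dual basis, so the cone is an intersection of
closed half-spaces. -/
theorem IsBasisSet.isClosed_simplexCone {s : Finset (Fin g)} (hs : IsBasisSet V s) :
    IsClosed (simplexCone V s) := by
  classical
  have hcoord : ∀ (c : Fin g → ℝ), ∀ i ∈ s,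
      ⟪∑ i ∈ s, c i • V i, tightPoint V s (-Pi.single i 1)⟫ = c i := by
    intro c i hi
    rw [hs.inner_sum_tightPoint]
    simp [Pi.single_apply, hi]
  have : simplexCone V s = ⋂ i ∈ s, {x | 0 ≤ ⟪x, tightPoint V s (-Pi.single i 1)⟫} := by
    ext x
    simp only [Set.mem_iInter, Set.mem_ofPred_eq]
    constructor
    · rintro ⟨c, hc, rfl⟩ i hi
      rw [hcoord c i hi]
      exact hc i
    · intro hx
      obtain ⟨c, rfl⟩ := hs.exists_eq_sum x
      exact mem_simplexCone (fun i hi => hcoord c i hi ▸ hx i hi) rfl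
  rw [this]
  exact isClosed_biInter fun i _ => isClosed_le (by fun_prop) (by fun_prop)

/-- The difference of the two sides of the inequality `j` at the point where the inequalities
in `s` are equalities. -/
def slack (V : Fin g → E d) (s : Finset (Fin g)) (j : Fin g) : (Fin g → ℝ) →ₗ[ℝ] ℝ :=
  LinearMap.proj j + innerₛₗ ℝ (V j) ∘ₗ tightPoint V s

theorem slack_apply (s : Finset (Fin g)) (j : Fin g) (h : Fin g → ℝ) :
    slack V s j h = h j + ⟪V j, tightPoint V s h⟫ := rfl

/-- Changing `h j` alone does not move the tight point of `s`, but it changes the slack of `j`. -/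
theorem IsBasisSet.slack_ne_zero {s : Finset (Fin g)} (hs : IsBasisSet V s) {j : Fin g}
    (hj : j ∉ s) : slack V s j ≠ 0 := by
  classical
  intro h0
  have h1 := congrArg (fun f => f (Pi.single j 1)) h0
  have h2 : tightPoint V s (Pi.single j 1) = 0 := hs.eq_zero fun i hi => by
    rw [hs.inner_tightPoint _ hi, Pi.single_eq_of_ne (fun h : i = j => hj (h ▸ hi)), neg_zero]
  simp [slack_apply, h2] at h1

/-- There is a perturbation of the right-hand sides which makes the system nondegenerate. -/
theorem exists_generic (V : Fin g → E d) :
    ∃ c : Fin g → ℝ, ∀ s, IsBasisSet V s → ∀ j, j ∉ s → slack V s j c ≠ 0 := by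
  classical
  by_contra hcon
  push Not at hcon
  let ι := {p : Finset (Fin g) × Fin g // IsBasisSet V p.1 ∧ p.2 ∉ p.1}
  -- A real vector space is not a finite union of proper subspaces, here the kernels of the slacks.
  obtain ⟨i, hi⟩ := Subspace.exists_eq_top_of_iUnion_eq_univ (k := ℝ) (E := Fin g → ℝ)
    (p := fun i : ι => LinearMap.ker (slack V i.1.1 i.1.2)) (by
      rw [Set.eq_univ_iff_forall]
      intro c
      obtain ⟨s, hs, j, hj, h0⟩ := hcon c
      exact Set.mem_iUnion.2 ⟨⟨(s, j), hs, hj⟩, h0⟩)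
  exact i.2.1.slack_ne_zero i.2.2 (LinearMap.ker_eq_top.1 hi)

/-- A nondegenerate perturbation of a strictly feasible system which creates no new vertices. -/
theorem exists_perturbation (V : Fin g → E d) (h : Fin g → ℝ) {x₀ : E d}
    (hx₀ : ∀ i, -h i < ⟪V i, x₀⟫) :
    ∃ h' : Fin g → ℝ, x₀ ∈ solutionSet V h' ∧
      ∀ s, IsBasisSet V s → ∀ j, j ∉ s →
        slack V s j h' ≠ 0 ∧ (0 ≤ slack V s j h' → 0 ≤ slack V s j h) := by
  classical
  obtain ⟨c, hc⟩ := exists_generic V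
  have h1 : ∀ᶠ ε : ℝ in nhdsWithin 0 (Set.Ioi 0), ∀ i, -(h + ε • c) i ≤ ⟪V i, x₀⟫ := by
    rw [Filter.eventually_all]
    intro i
    have hcont : Continuous fun ε : ℝ => -(h i + ε * c i) := by fun_prop
    have ht := (hcont.tendsto 0).mono_left (nhdsWithin_le_nhds (s := Set.Ioi 0))
    have hlt := ht.eventually_lt_const (u := ⟪V i, x₀⟫) (by simpa using hx₀ i)
    exact hlt.mono fun ε hε => by simpa using hε.le
  have h2 : ∀ᶠ ε : ℝ in nhdsWithin 0 (Set.Ioi 0), ∀ p : Finset (Fin g) × Fin g,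
      IsBasisSet V p.1 → p.2 ∉ p.1 → slack V p.1 p.2 (h + ε • c) ≠ 0 ∧
        (0 ≤ slack V p.1 p.2 (h + ε • c) → 0 ≤ slack V p.1 p.2 h) := by
    rw [Filter.eventually_all]
    rintro ⟨s, j⟩
    by_cases hs : IsBasisSet V s
    swap
    · exact Filter.Eventually.of_forall fun ε h => absurd h hs
    by_cases hj : j ∈ s
    · exact Filter.Eventually.of_forall fun ε _ h => absurd hj h
    have hcont : Continuous fun ε : ℝ => slack V s j h + ε * slack V s j c := by fun_prop
    have ht : Filter.Tendsto (fun ε : ℝ => slack V s j h + ε * slack V s j c)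
        (nhdsWithin 0 (Set.Ioi 0)) (nhds (slack V s j h)) := by
      simpa using (hcont.tendsto 0).mono_left nhdsWithin_le_nhds
    have hsimp : ∀ ε : ℝ, slack V s j (h + ε • c) = slack V s j h + ε * slack V s j c := by
      intro ε
      rw [map_add, map_smul, smul_eq_mul]
    simp only [hsimp]
    -- A nonzero slack keeps its sign for small `ε`; a zero slack becomes a nonzero multiple of `ε`.
    rcases lt_trichotomy (slack V s j h) 0 with hlt | heq | hgt
    · exact (ht.eventually (gt_mem_nhds hlt)).mono fun ε hε _ _ =>
        ⟨hε.ne, fun h => absurd h (not_le.2 hε)⟩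
    · filter_upwards [self_mem_nhdsWithin] with ε hε _ _
      rw [heq, zero_add]
      exact ⟨mul_ne_zero (ne_of_gt hε) (hc s hs j hj), fun _ => le_rfl⟩
    · exact (ht.eventually (lt_mem_nhds hgt)).mono fun ε hε _ _ => ⟨hε.ne', fun _ => hgt.le⟩
  obtain ⟨ε, h3, h4⟩ := (h1.and h2).exists
  exact ⟨h + ε • c, h3, fun s hs j hj => h4 (s, j) hs hj⟩

/-- The vertices of the perturbed system, given by bases: a point where the inequalities in `s`
are equalities, and all others are strict. -/
def IsVertexSet (V : Fin g → E d) (h : Fin g → ℝ) (s : Finset (Fin g)) : Prop :=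
  IsBasisSet V s ∧ ∀ j, j ∉ s → 0 < slack V s j h

/-- Weak duality of linear programming: sum the inequalities in `t` with the coefficients of `x`.
The tight point need not be feasible. -/
theorem inner_le_of_mem_simplexCone {h : Fin g → ℝ} {t : Finset (Fin g)} {y : E d}
    (ht : IsBasisSet V t) (hy : y ∈ solutionSet V h) {x : E d}
    (hx : x ∈ simplexCone V t) : ⟪x, tightPoint V t h⟫ ≤ ⟪x, y⟫ := by
  obtain ⟨c, hc, rfl⟩ := hx
  rw [ht.inner_sum_tightPoint, sum_inner, ← Finset.sum_neg_distrib]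
  refine Finset.sum_le_sum fun i _ => ?_
  rw [inner_smul_left]
  have := mul_le_mul_of_nonneg_left (hy i) (hc i)
  simpa using this

theorem IsVertexSet.tightPoint_mem {h : Fin g → ℝ} {s : Finset (Fin g)} (hs : IsVertexSet V h s) :
    tightPoint V s h ∈ solutionSet V h := by
  intro i
  by_cases hi : i ∈ s
  · rw [hs.1.inner_tightPoint h hi]
  · have := hs.2 i hi
    rw [slack_apply] at this
    linarith

/-- The cones of two vertices intersect in a common face. -/
theorem IsVertexSet.inter_eq {h : Fin g → ℝ} {s t : Finset (Fin g)} (hs : IsVertexSet V h s)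
    (ht : IsVertexSet V h t) :
    simplexCone V s ∩ simplexCone V t = simplexCone V (s ∩ t) := by
  refine Set.Subset.antisymm ?_ (Set.subset_inter (simplexCone_mono Finset.inter_subset_left)
    (simplexCone_mono Finset.inter_subset_right))
  rintro x ⟨hxs, hxt⟩
  have h1 := inner_le_of_mem_simplexCone hs.1 ht.tightPoint_mem hxs
  obtain ⟨c, hc, rfl⟩ := hxt
  -- Complementary slackness: these terms are nonnegative, so each vanishes, and `c i = 0` wherever
  -- inequality `i` is strict at the vertex of `s`.
  have h2 : ∑ i ∈ t, c i * (h i + ⟪V i, tightPoint V s h⟫) ≤ 0 := by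
    rw [ht.1.inner_sum_tightPoint, sum_inner] at h1
    simp only [inner_smul_left, conj_trivial] at h1
    simp only [mul_add, Finset.sum_add_distrib]
    linarith
  have hnonneg : ∀ i ∈ t, 0 ≤ c i * (h i + ⟪V i, tightPoint V s h⟫) := fun i _ =>
    mul_nonneg (hc i) (by linarith [hs.tightPoint_mem i])
  have h3 := (Finset.sum_eq_zero_iff_of_nonneg hnonneg).1
    (le_antisymm h2 (Finset.sum_nonneg hnonneg))
  refine ⟨c, hc, ?_⟩
  refine (Finset.sum_subset Finset.inter_subset_right fun i hi hni => ?_).symm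
  have his : i ∉ s := fun his => hni (Finset.mem_inter.2 ⟨his, hi⟩)
  have := (mul_eq_zero.1 (h3 i hi)).resolve_right (hs.2 i his).ne'
  rw [this, zero_smul]

/-- The points that lie in no subspace spanned by fewer than `d` of the vectors. -/
def IsGenericPoint (V : Fin g → E d) (x : E d) : Prop :=
  ∀ s : Finset (Fin g), s.card < d → x ∉ Submodule.span ℝ (V '' (s : Set (Fin g)))

theorem volume_span_image_eq_zero {s : Finset (Fin g)} (hs : s.card < d) :
    volume (Submodule.span ℝ (V '' (s : Set (Fin g))) : Set (E d)) = 0 := by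
  classical
  refine Measure.addHaar_submodule _ _ fun htop => ?_
  have h1 := finrank_span_finset_le_card (R := ℝ) (s.image V)
  rw [Finset.coe_image, Set.finrank, htop, finrank_top, finrank_euclideanSpace_fin] at h1
  exact absurd (h1.trans Finset.card_image_le) (not_le.2 hs)

theorem dense_isGenericPoint (V : Fin g → E d) : Dense {x | IsGenericPoint V x} := by
  classical
  refine Measure.dense_of_ae (μ := (volume : Measure (E d))) ?_
  unfold IsGenericPoint
  rw [ae_all_iff]
  intro s
  by_cases hs : s.card < d
  · have hne : Submodule.span ℝ (V '' (s : Set (Fin g))) ≠ ⊤ := by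
      intro htop
      have h1 := finrank_span_finset_le_card (R := ℝ) (s.image V)
      rw [Finset.coe_image, Set.finrank, htop, finrank_top, finrank_euclideanSpace_fin] at h1
      exact absurd (h1.trans Finset.card_image_le) (not_le.2 hs)
    have := Measure.addHaar_submodule (volume : Measure (E d)) _ hne
    filter_upwards [measure_eq_zero_iff_ae_notMem.1 this] with x hx _
    exact hx
  · exact Filter.Eventually.of_forall fun x h => absurd h hs

theorem IsGenericPoint.exists_isBasisSet {x : E d} (hx : IsGenericPoint V x)
    {s : Finset (Fin g)} (hs : x ∈ simplexCone V s) :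
    ∃ t ⊆ s, IsBasisSet V t ∧ x ∈ simplexCone V t := by
  obtain ⟨t, hts, hli, hxt⟩ := exists_linearIndepOn_mem_simplexCone hs
  refine ⟨t, hts, ⟨le_antisymm ?_ ?_, hli⟩, hxt⟩
  · have := LinearIndependent.fintype_card_le_finrank (R := ℝ) (b := fun i : t => V i) hli
    rwa [Fintype.card_coe, finrank_euclideanSpace_fin] at this
  · by_contra hlt
    exact hx t (not_le.1 hlt) (simplexCone_subset_span t hxt)

/-- One step of the simplex method: a basis with a violated inequality can be improved. -/
theorem IsGenericPoint.exists_improvement {h : Fin g → ℝ} {x₀ : E d}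
    (hx₀ : x₀ ∈ solutionSet V h) {x : E d} (hx : IsGenericPoint V x) {s : Finset (Fin g)}
    (hs : IsBasisSet V s) (hxs : x ∈ simplexCone V s) {j : Fin g}
    (hj : slack V s j h < 0) :
    ∃ t, IsBasisSet V t ∧ x ∈ simplexCone V t ∧
      ⟪x, tightPoint V s h⟫ < ⟪x, tightPoint V t h⟫ := by
  classical
  have hjs : j ∉ s := fun hjs => by
    rw [slack_apply, hs.inner_tightPoint h hjs] at hj
    linarith
  obtain ⟨α, hα⟩ := hs.exists_eq_sum (V j)
  have hslack : slack V s j h = h j - ∑ i ∈ s, α i * h i := by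
    rw [slack_apply, hα, hs.inner_sum_tightPoint]
    ring
  -- If all `α i ≤ 0`, the inequalities in `s` would force every feasible point, such as `x₀`, to
  -- violate inequality `j`.
  have hpos : ∃ i ∈ s, 0 < α i := by
    by_contra! hcon
    have h1 : ⟪V j, x₀⟫ = ∑ i ∈ s, α i * ⟪V i, x₀⟫ := by
      conv_lhs => rw [hα]
      rw [sum_inner]
      exact Finset.sum_congr rfl fun i _ => by simp [inner_smul_left]
    have h2 : ∑ i ∈ s, α i * ⟪V i, x₀⟫ ≤ ∑ i ∈ s, -(α i * h i) :=
      Finset.sum_le_sum fun i hi => by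
        have := mul_le_mul_of_nonpos_left (hx₀ i) (hcon i hi)
        linarith
    rw [Finset.sum_neg_distrib] at h2
    linarith [hx₀ j]
  have hxs' := hxs
  obtain ⟨c, hc, hxc⟩ := hxs
  obtain ⟨k, hk, hαk, hrat⟩ := exists_ratio hc hpos
  set r := c k / α k with hr
  have hr0 : 0 ≤ r := div_nonneg (hc k) hαk.le
  have hjk : j ∉ s.erase k := fun h => hjs (Finset.mem_of_mem_erase h)
  -- Coordinates of `x` after the pivot: `j` enters with coefficient `r`, and the coefficient of `k`
  -- drops to zero.
  set e : Fin g → ℝ := fun i => if i = j then r else c i - r * α i with he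
  have hek : c k - r * α k = 0 := by rw [hr, div_mul_cancel₀ _ hαk.ne', sub_self]
  -- Needed twice: for the vectors `V`, and for the right-hand sides `h`, where it compares the
  -- objective values.
  have hesum : ∀ {M : Type} [AddCommGroup M] [Module ℝ M] (W : Fin g → M),
      ∑ i ∈ insert j (s.erase k), e i • W i =
        ∑ i ∈ s, c i • W i + r • (W j - ∑ i ∈ s, α i • W i) := by
    intro M _ _ W
    rw [Finset.sum_insert hjk]
    have h1 : ∑ i ∈ s.erase k, e i • W i = ∑ i ∈ s, (c i - r * α i) • W i := by
      rw [← Finset.sum_erase_add s _ hk, hek, zero_smul, add_zero]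
      refine Finset.sum_congr rfl fun i hi => ?_
      rw [he]
      dsimp only
      rw [if_neg (fun h : i = j => hjk (h ▸ hi))]
    rw [h1]
    simp only [he, if_true, sub_smul, mul_smul, Finset.sum_sub_distrib, ← Finset.smul_sum,
      smul_sub]
    abel
  have hxe : x = ∑ i ∈ insert j (s.erase k), e i • V i := by
    rw [hesum, ← hα, sub_self, smul_zero, add_zero, hxc]
  have hxmem : x ∈ simplexCone V (insert j (s.erase k)) := by
    refine mem_simplexCone (fun i hi => ?_) hxe
    rw [he]
    dsimp only
    split_ifs with hij
    · exact hr0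
    · exact hrat i (Finset.mem_of_mem_erase ((Finset.mem_insert.1 hi).resolve_left hij))
  have hcard : (insert j (s.erase k)).card = d := by
    rw [Finset.card_insert_of_notMem hjk, Finset.card_erase_add_one hk, hs.1]
  obtain ⟨t, hts, ht, hxt⟩ := hx.exists_isBasisSet hxmem
  obtain rfl := Finset.eq_of_subset_of_card_le hts (by rw [hcard, ht.1])
  refine ⟨_, ht, hxt, ?_⟩
  -- If `r = 0`, then `c k = 0` and `x` lies in the span of `d - 1` vectors, against genericity.
  have hrpos : 0 < r := by
    refine lt_of_le_of_ne hr0 fun h0 => ?_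
    refine hx (s.erase k) ?_ (simplexCone_subset_span _ (mem_simplexCone (fun i _ => hc i) ?_))
    · rw [← hs.1]
      exact Finset.card_erase_lt_of_mem hk
    · rw [hxc, ← Finset.sum_erase_add s _ hk]
      rw [← h0, zero_mul, sub_zero] at hek
      rw [hek, zero_smul, add_zero]
  have h3 := hesum h
  simp only [smul_eq_mul] at h3
  rw [← hslack] at h3
  have h4 : ⟪x, tightPoint V s h⟫ = -∑ i ∈ s, c i * h i := by
    rw [hxc, hs.inner_sum_tightPoint]
  have h5 : ⟪x, tightPoint V (insert j (s.erase k)) h⟫ =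
      -∑ i ∈ insert j (s.erase k), e i * h i := by
    rw [hxe, ht.inner_sum_tightPoint]
  rw [h4, h5, h3]
  have := mul_neg_of_pos_of_neg hrpos hj
  linarith

/-- Among the finitely many bases whose cone contains `x`, one maximising `⟪x, tightPoint V s h⟫`
admits no improvement. Its slacks are therefore nonnegative, and nonzero by `hgen`. -/
theorem IsGenericPoint.exists_isVertexSet {h : Fin g → ℝ} {x₀ : E d}
    (hx₀ : x₀ ∈ solutionSet V h)
    (hgen : ∀ s, IsBasisSet V s → ∀ j, j ∉ s → slack V s j h ≠ 0)
    {x : E d} (hx : IsGenericPoint V x) (hmem : x ∈ simplexCone V Finset.univ) :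
    ∃ s, IsVertexSet V h s ∧ x ∈ simplexCone V s := by
  classical
  obtain ⟨s, hs, hmax⟩ := Finset.exists_max_image
    (Finset.univ.filter fun s => IsBasisSet V s ∧ x ∈ simplexCone V s)
    (fun s => ⟪x, tightPoint V s h⟫) (by
      obtain ⟨t, -, ht⟩ := hx.exists_isBasisSet hmem
      exact ⟨t, by simpa using ht⟩)
  rw [Finset.mem_filter] at hs
  obtain ⟨-, hs, hxs⟩ := hs
  refine ⟨s, ⟨hs, fun j hj => ?_⟩, hxs⟩
  by_contra hneg
  obtain ⟨t, ht, hxt, hlt⟩ := hx.exists_improvement hx₀ hs hxs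
    (lt_of_le_of_ne (not_lt.1 hneg) (hgen s hs j hj))
  exact absurd (hmax t (by simpa using ⟨ht, hxt⟩)) (not_le.2 hlt)

/-- The cones of the vertices cover the cone spanned by all the vectors. -/
theorem exists_isVertexSet_of_mem_simplexCone (hspan : Submodule.span ℝ (Set.range V) = ⊤)
    {h : Fin g → ℝ} {x₀ : E d} (hx₀ : x₀ ∈ solutionSet V h)
    (hgen : ∀ s, IsBasisSet V s → ∀ j, j ∉ s → slack V s j h ≠ 0)
    {x : E d} (hmem : x ∈ simplexCone V Finset.univ) :
    ∃ s, IsVertexSet V h s ∧ x ∈ simplexCone V s := by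
  have hclosed : IsClosed (⋃ s : {s // IsVertexSet V h s}, simplexCone V s.1) :=
    isClosed_iUnion_of_finite fun s => s.2.1.isClosed_simplexCone
  have hconv := convex_simplexCone (V := V) Finset.univ
  have hzero : (0 : E d) ∈ simplexCone V Finset.univ := ⟨0, fun _ => le_rfl, by simp⟩
  have hint : (interior (simplexCone V Finset.univ)).Nonempty := by
    rw [hconv.interior_nonempty_iff_affineSpan_eq_top,
      AffineSubspace.affineSpan_eq_top_iff_vectorSpan_eq_top_of_nonempty ℝ _ _ ⟨0, hzero⟩,
      eq_top_iff, ← hspan, Submodule.span_le]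
    rintro _ ⟨i, rfl⟩
    simpa using vsub_mem_vectorSpan ℝ (mem_simplexCone_of_mem (V := V) (Finset.mem_univ i)) hzero
  -- Generic points are dense in the interior of the full-dimensional cone, and a finite union of
  -- closed cones that contains them contains their limits.
  have h1 : x ∈ closure (interior (simplexCone V Finset.univ)) := by
    rw [hconv.closure_interior_eq_closure_of_nonempty_interior hint]
    exact subset_closure hmem
  have h2 := closure_minimal ((dense_isGenericPoint V).open_subset_closure_inter isOpen_interior)
    isClosed_closure h1
  have h3 : x ∈ ⋃ s : {s // IsVertexSet V h s}, simplexCone V s.1 := by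
    refine closure_minimal ?_ hclosed h2
    rintro y ⟨hy, hyg⟩
    obtain ⟨s, hs, hys⟩ := IsGenericPoint.exists_isVertexSet hx₀ hgen hyg (interior_subset hy)
    exact Set.mem_iUnion.2 ⟨⟨s, hs⟩, hys⟩
  obtain ⟨⟨s, hs⟩, hxs⟩ := Set.mem_iUnion.1 h3
  exact ⟨s, hs, hxs⟩

end Cones

/-! ### Rays and vertices of the normal fan -/

section NormalFan

variable {g : ℕ} {V : Fin g → E d} {h : Fin g → ℝ}

/-- The inequalities of an irredundant system define rays of the normal fan. -/
theorem IsIrredundant.ray_mem_normalFan (hV : IsIrredundant V h) {x₀ : E d}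
    (hx₀ : ∀ i, -h i < ⟪V i, x₀⟫) (i : Fin g) : ray (V i) ∈ normalFan (solutionSet V h) := by
  obtain ⟨p, hp, hp'⟩ := hV.exists_tight hx₀ i
  have hpP : p ∈ solutionSet V h := fun j => by
    by_cases hj : j = i
    · rw [hj, hp]
    · exact (hp' j hj).le
  have hmin : ∀ x ∈ solutionSet V h, ⟪V i, p⟫ ≤ ⟪V i, x⟫ := fun x hx => hp ▸ hx i
  refine ⟨_, exists_isFace_setOf hpP hmin, ?_⟩
  set F := {x ∈ solutionSet V h | ∀ y ∈ solutionSet V h, ⟪V i, x⟫ ≤ ⟪V i, y⟫} with hF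
  have hsub : F ⊆ solutionSet V h := fun x hx => hx.1
  have hpF : p ∈ F := ⟨hpP, hmin⟩
  ext v
  rw [mem_normalCone_iff hsub]
  constructor
  · rintro ⟨t, ht, rfl⟩ y hy x hx
    rw [inner_smul_left, inner_smul_left]
    exact mul_le_mul_of_nonneg_left (hy.2 x hx) ht
  · intro hv
    have hx₀P : x₀ ∈ solutionSet V h := fun i => (hx₀ i).le
    -- Only inequality `i` is tight at `p`, so small moves orthogonal to `V i` are feasible. Applied
    -- to `u` and `-u`, this makes `v` a multiple of `V i`; comparing `p` with `x₀` fixes the sign.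
    have horth : ∀ u, ⟪V i, u⟫ = 0 → 0 ≤ ⟪v, u⟫ := by
      intro u hu
      obtain ⟨ε, hε, hmem⟩ := exists_add_smul_mem hpP (u := u) fun j hj => by
        by_cases hji : j = i
        · rw [hji, hu]
        · exact absurd hj (hp' j hji).ne'
      have := hv p hpF _ hmem
      rw [inner_add_right, inner_smul_right] at this
      exact nonneg_of_mul_nonneg_right (by linarith) hε
    have hVi : ⟪V i, V i⟫ ≠ 0 := fun h0 =>
      hV.ne_zero ⟨x₀, hx₀P⟩ i (inner_self_eq_zero.1 h0)
    set t := ⟪V i, v⟫ / ⟪V i, V i⟫ with ht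
    have hu : ⟪V i, v - t • V i⟫ = 0 := by
      rw [inner_sub_right, inner_smul_right, ht, div_mul_cancel₀ _ hVi, sub_self]
    have hv0 : v - t • V i = 0 := by
      have h1 := horth (-(v - t • V i)) (by rw [inner_neg_right, hu, neg_zero])
      have h2 : ⟪v, v - t • V i⟫ = ⟪v - t • V i, v - t • V i⟫ := by
        conv_rhs => rw [inner_sub_left, inner_smul_left, hu, mul_zero, sub_zero]
      rw [inner_neg_right, h2] at h1
      exact inner_self_eq_zero.1 (le_antisymm (by linarith) real_inner_self_nonneg)
    have hvt : v = t • V i := sub_eq_zero.1 hv0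
    refine ⟨t, ?_, hvt⟩
    have h1 := hv p hpF x₀ hx₀P
    rw [hvt, inner_smul_left, inner_smul_left, hp] at h1
    simp only [conj_trivial] at h1
    by_contra hneg
    have := mul_lt_mul_of_neg_left (hx₀ i) (not_le.1 hneg)
    linarith

/-- The rays defined by different inequalities of an irredundant system are different. -/
theorem IsIrredundant.ray_injective (hV : IsIrredundant V h) {x₀ : E d}
    (hx₀ : ∀ i, -h i < ⟪V i, x₀⟫) {i j : Fin g} (hij : ray (V i) = ray (V j)) : i = j := by
  by_contra hne
  obtain ⟨p, hp, hp'⟩ := hV.exists_tight hx₀ i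
  obtain ⟨q, hq, hq'⟩ := hV.exists_tight hx₀ j
  have hmem : V i ∈ ray (V j) := hij ▸ mem_ray_self (V i)
  obtain ⟨t, ht, hVi⟩ := hmem
  have h1 := hp' j (Ne.symm hne)
  have h2 := hq' i hne
  rw [hVi, inner_smul_left] at hp h2
  simp only [conj_trivial] at hp h2
  rw [hq] at h2
  have := mul_le_mul_of_nonneg_left h1.le ht
  linarith

/-- Every ray of the normal fan is defined by an inequality of the system. -/
theorem exists_ray_eq_of_mem_normalFan
    (hV : ∀ i, V i ≠ 0) {v : E d} (hv : v ≠ 0) (hray : ray v ∈ normalFan (solutionSet V h)) :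
    ∃ i, ray (V i) = ray v := by
  obtain ⟨F, hF, hFv⟩ := hray
  obtain ⟨x, hx, hx'⟩ := hF.exists_relative_interior
  by_cases hi : ∃ i, ⟪V i, x⟫ = -h i
  · obtain ⟨i, hi⟩ := hi
    have := mem_normalCone_of_tight hF.subset (hx' i hi)
    rw [← hFv] at this
    exact ⟨i, ray_eq_of_mem this (hV i)⟩
  · push Not at hi
    exfalso
    have hmin := (mem_normalCone_iff hF.subset).1 (hFv ▸ mem_ray_self v) x hx
    -- With nothing tight at `x`, a move along `-v` is feasible and lowers the minimum.
    obtain ⟨ε, hε, hmem⟩ := exists_add_smul_mem (hF.subset hx) (u := -v) fun i h => absurd h (hi i)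
    have := hmin _ hmem
    rw [inner_add_right, inner_smul_right, inner_neg_right] at this
    have h2 : 0 < ⟪v, v⟫ := real_inner_self_pos.2 hv
    have := mul_pos hε h2
    linarith

/-- The sum of the basis vectors is minimal only at this point: equality in the summed inequalities
forces each of them to be tight. -/
theorem IsBasisSet.isFace_singleton {s : Finset (Fin g)} (hs : IsBasisSet V s)
    (hmem : tightPoint V s h ∈ solutionSet V h) :
    IsFace (solutionSet V h) {tightPoint V s h} := by
  refine isFace_iff.2 ⟨Set.singleton_nonempty _, ∑ i ∈ s, (1 : ℝ) • V i, ?_⟩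
  have hcone : ∑ i ∈ s, (1 : ℝ) • V i ∈ simplexCone V s := ⟨1, fun _ => zero_le_one, rfl⟩
  ext x
  simp only [Set.mem_singleton_iff, Set.mem_ofPred_eq]
  constructor
  · rintro rfl
    exact ⟨hmem, fun y hy => inner_le_of_mem_simplexCone hs hy hcone⟩
  · rintro ⟨hx, hxmin⟩
    have h1 := hxmin _ hmem
    rw [hs.inner_sum_tightPoint, sum_inner] at h1
    simp only [one_smul, one_mul] at h1
    have h2 : ∑ i ∈ s, (h i + ⟪V i, x⟫) ≤ 0 := by
      rw [Finset.sum_add_distrib]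
      linarith
    have h3 := (Finset.sum_eq_zero_iff_of_nonneg fun i _ => by linarith [hx i]).1
      (le_antisymm h2 (Finset.sum_nonneg fun i _ => by linarith [hx i]))
    refine sub_eq_zero.1 (hs.eq_zero fun i hi => ?_)
    rw [inner_sub_right, hs.inner_tightPoint h hi]
    linarith [h3 i hi]

theorem IsBasisSet.simplexCone_subset_normalCone {s : Finset (Fin g)} (hs : IsBasisSet V s)
    (hmem : tightPoint V s h ∈ solutionSet V h) :
    simplexCone V s ⊆ normalCone (solutionSet V h) {tightPoint V s h} := by
  intro x hx
  rw [mem_normalCone_iff (Set.singleton_subset_iff.2 hmem)]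
  rintro y rfl p hp
  exact inner_le_of_mem_simplexCone hs hp hx

/-- The support function is finite only on the cone spanned by the normal vectors. -/
theorem mem_simplexCone_of_supportFun_ne_top {v : E d}
    (hclosed : IsClosed (simplexCone V Finset.univ)) (hne : (solutionSet V h).Nonempty)
    (hv : supportFun (solutionSet V h) v ≠ ⊤) : v ∈ simplexCone V Finset.univ := by
  by_contra hnot
  -- The separating functional gives a direction `w` of recession of the polyhedron with `⟪v, w⟫ <
  -- 0`, along which `-⟪v, ·⟫` is unbounded above.
  obtain ⟨f, u, hfv, hf⟩ := geometric_hahn_banach_point_closed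
    (convex_simplexCone (V := V) Finset.univ) hclosed hnot
  set w := (InnerProductSpace.toDual ℝ (E d)).symm f with hw
  have hfw : ∀ x, f x = ⟪x, w⟫ := fun x => by
    rw [real_inner_comm, hw, InnerProductSpace.toDual_symm_apply]
  have hu : u < 0 := by
    simpa using hf 0 ⟨0, fun _ => le_rfl, by simp⟩
  have hVw : ∀ i, 0 ≤ ⟪V i, w⟫ := by
    intro i
    by_contra hneg
    push Not at hneg
    have h1 : (u / ⟪V i, w⟫) • V i ∈ simplexCone V Finset.univ :=
      mem_simplexCone (c := Pi.single i (u / ⟪V i, w⟫)) (fun j _ => by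
        by_cases hj : j = i
        · subst hj
          simpa using (div_pos_of_neg_of_neg hu hneg).le
        · simp [hj]) (by simp [Pi.single_apply])
    have h2 := hf _ h1
    rw [hfw, inner_smul_left] at h2
    simp only [conj_trivial] at h2
    rw [div_mul_cancel₀ _ hneg.ne] at h2
    exact lt_irrefl _ h2
  have hvw : ⟪v, w⟫ < 0 := hfw v ▸ hfv.trans hu
  obtain ⟨x, hx⟩ := hne
  refine hv (EReal.eq_top_iff_forall_lt _ |>.2 fun y => ?_)
  obtain ⟨t, ht⟩ : ∃ t : ℝ, 0 ≤ t ∧ y < -⟪v, x⟫ - t * ⟪v, w⟫ := by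
    refine ⟨(|y + ⟪v, x⟫| + 1) / -⟪v, w⟫, div_nonneg (by positivity) (by linarith), ?_⟩
    have : (|y + ⟪v, x⟫| + 1) / -⟪v, w⟫ * ⟪v, w⟫ = -(|y + ⟪v, x⟫| + 1) := by
      rw [div_neg, neg_mul, div_mul_cancel₀ _ hvw.ne]
    rw [this]
    linarith [le_abs_self (y + ⟪v, x⟫)]
  have hmem : x + t • w ∈ solutionSet V h := fun i => by
    rw [inner_add_right, inner_smul_right]
    have := mul_nonneg ht.1 (hVw i)
    linarith [hx i]
  refine lt_of_lt_of_le (EReal.coe_lt_coe_iff.2 ht.2) (le_trans (le_of_eq ?_)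
    (neg_inner_le_supportFun hmem))
  congr 1
  rw [inner_add_right, inner_smul_right]
  ring

theorem supportFun_ne_top_of_mem_sUnion {P : Set (E d)} {v : E d} (hv : v ∈ ⋃₀ normalFan P) :
    supportFun P v ≠ ⊤ := by
  obtain ⟨_, ⟨F, hF, rfl⟩, hvF⟩ := hv
  obtain ⟨y, hy⟩ := hF.2
  rw [hvF y hy]
  exact EReal.coe_ne_top _

end NormalFan

/-! ### Triangulation of the normal fan -/

/-- Data of a full-dimensional polyhedron without lines: a system of inequalities, and the bases
that define the simplices of a triangulation of the normal fan. -/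
structure VertexData {g : ℕ} (V : Fin g → E d) (h : Fin g → ℝ)
    (S : Finset (Finset (Fin g))) : Prop where
  isBasisSet : ∀ s ∈ S, IsBasisSet V s
  tightPoint_mem : ∀ s ∈ S, tightPoint V s h ∈ solutionSet V h
  inter_eq : ∀ s ∈ S, ∀ t ∈ S, simplexCone V s ∩ simplexCone V t = simplexCone V (s ∩ t)
  covers : ∀ x ∈ simplexCone V Finset.univ, ∃ s ∈ S, x ∈ simplexCone V s

section VertexData

variable {g : ℕ} {V : Fin g → E d} {h : Fin g → ℝ} {S : Finset (Finset (Fin g))}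

/-- The simplices are the vertices of the perturbed system. The perturbation creates no new
vertices, so their tight points for `h` are feasible too; several simplices may share one, and then
subdivide its normal cone. -/
theorem exists_vertexData (hspan : Submodule.span ℝ (Set.range V) = ⊤) {x₀ : E d}
    (hx₀ : ∀ i, -h i < ⟪V i, x₀⟫) : ∃ S, VertexData V h S := by
  classical
  obtain ⟨h', hx₀', hh'⟩ := exists_perturbation V h hx₀
  refine ⟨Finset.univ.filter (IsVertexSet V h'), ?_, ?_, ?_, ?_⟩
  · intro s hs
    exact (Finset.mem_filter.1 hs).2.1
  · intro s hs
    obtain ⟨-, hs⟩ := Finset.mem_filter.1 hs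
    intro i
    by_cases hi : i ∈ s
    · rw [hs.1.inner_tightPoint h hi]
    · have := (hh' s hs.1 i hi).2 (hs.2 i hi).le
      rw [slack_apply] at this
      linarith
  · intro s hs t ht
    exact (Finset.mem_filter.1 hs).2.inter_eq (Finset.mem_filter.1 ht).2
  · intro x hx
    obtain ⟨s, hs, hxs⟩ := exists_isVertexSet_of_mem_simplexCone hspan hx₀'
      (fun s hs j hj => (hh' s hs j hj).1) hx
    exact ⟨s, by simpa using hs, hxs⟩

theorem VertexData.isClosed (hS : VertexData V h S) :
    IsClosed (simplexCone V Finset.univ) := by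
  have : simplexCone V Finset.univ = ⋃ s ∈ S, simplexCone V s := by
    ext x
    simp only [Set.mem_iUnion, exists_prop]
    exact ⟨hS.covers x, fun ⟨s, _, hx⟩ => simplexCone_mono (Finset.subset_univ s) hx⟩
  rw [this]
  exact S.finite_toSet.isClosed_biUnion fun s hs => (hS.isBasisSet s hs).isClosed_simplexCone

theorem VertexData.normalCone_mem (hS : VertexData V h S) {s : Finset (Fin g)} (hs : s ∈ S) :
    normalCone (solutionSet V h) {tightPoint V s h} ∈ normalFan (solutionSet V h) :=
  ⟨_, (hS.isBasisSet s hs).isFace_singleton (hS.tightPoint_mem s hs), rfl⟩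

theorem VertexData.exists_of_supportFun_ne_top (hS : VertexData V h S)
    (hne : (solutionSet V h).Nonempty) {v : E d} (hv : supportFun (solutionSet V h) v ≠ ⊤) :
    ∃ s ∈ S, v ∈ simplexCone V s :=
  hS.covers v (mem_simplexCone_of_supportFun_ne_top hS.isClosed hne hv)

theorem VertexData.iUnion_eq (hS : VertexData V h S) (hne : (solutionSet V h).Nonempty) :
    (⋃ s ∈ S, simplexCone V s) = ⋃₀ normalFan (solutionSet V h) := by
  ext v
  constructor
  · intro hv
    simp only [Set.mem_iUnion, exists_prop] at hv
    obtain ⟨s, hs, hv⟩ := hv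
    exact ⟨_, hS.normalCone_mem hs, (hS.isBasisSet s hs).simplexCone_subset_normalCone
      (hS.tightPoint_mem s hs) hv⟩
  · intro hv
    obtain ⟨s, hs, hvs⟩ := hS.exists_of_supportFun_ne_top hne (supportFun_ne_top_of_mem_sUnion hv)
    simp only [Set.mem_iUnion, exists_prop]
    exact ⟨s, hs, hvs⟩

theorem VertexData.isPureOfDim (hS : VertexData V h S) :
    IsPureOfDim (normalFan (solutionSet V h)) d := by
  rintro C ⟨⟨F, hF, rfl⟩, hmax⟩
  obtain ⟨⟨y, hy⟩, v, hv⟩ := isFace_iff.1 hF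
  have hvF : v ∈ normalCone (solutionSet V h) F := by
    rw [mem_normalCone_iff hF.subset]
    intro y hy
    rw [hv] at hy
    exact hy.2
  obtain ⟨s, hs, hvs⟩ := hS.exists_of_supportFun_ne_top ⟨y, hF.subset hy⟩
    (supportFun_ne_top_of_mem_sUnion ⟨_, ⟨F, hF, rfl⟩, hvF⟩)
  -- The functional defining `F` lies in the cone of `s`, so `F` contains that vertex. By maximality
  -- the normal cone of `F` is that of the vertex, which contains a basis.
  have hyF : tightPoint V s h ∈ F := by
    rw [hv]
    exact ⟨hS.tightPoint_mem s hs, fun p hp =>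
      inner_le_of_mem_simplexCone (hS.isBasisSet s hs) hp hvs⟩
  have h1 : normalCone (solutionSet V h) F ⊆ normalCone (solutionSet V h) {tightPoint V s h} := by
    rintro w hw _ rfl
    exact hw _ hyF
  have h2 := hmax (hS.normalCone_mem hs) h1
  have h3 : Submodule.span ℝ (normalCone (solutionSet V h) F) = ⊤ := by
    rw [eq_top_iff, ← (hS.isBasisSet s hs).span_eq_top]
    refine Submodule.span_mono ?_
    rintro _ ⟨i, hi, rfl⟩
    exact h2 ((hS.isBasisSet s hs).simplexCone_subset_normalCone (hS.tightPoint_mem s hs)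
      (mem_simplexCone_of_mem hi))
  rw [h3, finrank_top, finrank_euclideanSpace_fin]

end VertexData

/-- The support function of a polyhedron is finite exactly on the support of its normal fan, and
the normal fan of a full-dimensional polyhedron without lines has a triangulation. -/
theorem IsIrredundant.exists_fanTriangulation {g : ℕ} {V : Fin g → E d} {h : Fin g → ℝ}
    (hV : IsIrredundant V h) (hint : (interior (solutionSet V h)).Nonempty)
    (hspan : Submodule.span ℝ (Set.range V) = ⊤) :
    IsPureOfDim (normalFan (solutionSet V h)) d ∧
      Nonempty (FanTriangulation (normalFan (solutionSet V h))) ∧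
      ∀ v, supportFun (solutionSet V h) v ≠ ⊤ → v ∈ ⋃₀ normalFan (solutionSet V h) := by
  obtain ⟨x₀, hx₀⟩ := hint
  have hne : (solutionSet V h).Nonempty := ⟨x₀, interior_subset hx₀⟩
  have hstrict : ∀ i, -h i < ⟪V i, x₀⟫ := fun i =>
    lt_inner_of_mem_interior hx₀ (hV.ne_zero hne i)
  obtain ⟨S, hS⟩ := exists_vertexData hspan hstrict
  refine ⟨hS.isPureOfDim, ⟨?_⟩, fun v hv => ?_⟩
  · exact
      { g := g
        gen := V
        gen_ne_zero := hV.ne_zero hne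
        gen_ray := hV.ray_mem_normalFan hstrict
        gen_unique := fun v hv hray => by
          obtain ⟨i, hi⟩ := exists_ray_eq_of_mem_normalFan (hV.ne_zero hne) hv hray
          exact ⟨i, hi, fun j hj => hV.ray_injective hstrict (hj.trans hi.symm)⟩
        simplices := S
        card_eq := fun s hs => (hS.isBasisSet s hs).1
        linearIndependent := fun s hs => (hS.isBasisSet s hs).2
        subordinate := fun s hs => ⟨_, hS.normalCone_mem hs,
          (hS.isBasisSet s hs).simplexCone_subset_normalCone (hS.tightPoint_mem s hs)⟩
        covers := hS.iUnion_eq hne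
        inter_eq := hS.inter_eq }
  · rw [← hS.iUnion_eq hne]
    obtain ⟨s, hs, hvs⟩ := hS.exists_of_supportFun_ne_top hne hv
    simp only [Set.mem_iUnion, exists_prop]
    exact ⟨s, hs, hvs⟩

/-! ### The integral of an exponential over a simplicial cone -/

theorem lintegral_pi_prod {n : ℕ} {f : Fin n → ℝ → ℝ≥0∞} (hf : ∀ i, Measurable (f i)) :
    ∫⁻ x : Fin n → ℝ, ∏ i, f i (x i) = ∏ i, ∫⁻ t, f i t := by
  induction n with
  | zero => simp [volume_pi]
  | succ n ih =>
    have hmp := (volume_preserving_piFinSuccAbove (fun _ : Fin (n + 1) => ℝ) 0).symm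
    rw [← hmp.lintegral_comp_emb (MeasurableEquiv.measurableEmbedding _)]
    simp only [Fin.prod_univ_succ, MeasurableEquiv.piFinSuccAbove_symm_apply,
      Fin.insertNthEquiv_apply, Fin.insertNth_zero', Fin.cons_zero, Fin.cons_succ]
    rw [← ih fun i => hf i.succ]
    refine lintegral_prod_mul (μ := (volume : Measure ℝ)) (ν := (volume : Measure (Fin n → ℝ)))
      (g := fun x => ∏ i, f i.succ (x i)) (hf 0).aemeasurable (Measurable.aemeasurable ?_)
    exact Finset.measurable_prod _ fun i _ => (hf i.succ).comp (measurable_pi_apply i)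

/-- The integral of `exp (-a t)` over the nonnegative half-line. -/
def expHalfLine (a : ℝ) : ℝ≥0∞ := ∫⁻ t in Set.Ici (0 : ℝ), ENNReal.ofReal (Real.exp (-(a * t)))

theorem expHalfLine_of_pos {a : ℝ} (ha : 0 < a) : expHalfLine a = ENNReal.ofReal a⁻¹ := by
  have h1 : IntegrableOn (fun t => Real.exp (-a * t)) (Set.Ioi 0) := exp_neg_integrableOn_Ioi 0 ha
  have h2 := integral_exp_mul_Ioi (neg_lt_zero.2 ha) 0
  rw [mul_zero, Real.exp_zero] at h2
  rw [expHalfLine, setLIntegral_congr Ioi_ae_eq_Ici.symm]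
  simp only [← neg_mul]
  rw [← ofReal_integral_eq_lintegral_ofReal h1
    (Filter.Eventually.of_forall fun t => (Real.exp_pos _).le), h2]
  congr 1
  field_simp

theorem expHalfLine_of_nonpos {a : ℝ} (ha : a ≤ 0) : expHalfLine a = ⊤ := by
  rw [expHalfLine, eq_top_iff]
  calc (⊤ : ℝ≥0∞) = ∫⁻ _ in Set.Ici (0 : ℝ), 1 := by simp
    _ ≤ _ := by
      refine setLIntegral_mono (by fun_prop) fun t ht => ?_
      rw [ENNReal.one_le_ofReal, Real.one_le_exp_iff, ← neg_mul]
      exact mul_nonneg (by linarith) ht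

/-- Excludes `0 * ∞`: a single infinite factor makes the whole product infinite. -/
theorem expHalfLine_ne_zero (a : ℝ) : expHalfLine a ≠ 0 := by
  rcases le_or_gt a 0 with ha | ha
  · rw [expHalfLine_of_nonpos ha]
    exact ENNReal.top_ne_zero
  · rw [expHalfLine_of_pos ha]
    exact (ENNReal.ofReal_pos.2 (inv_pos.2 ha)).ne'

theorem setLIntegral_orthant (a : Fin d → ℝ) :
    ∫⁻ x : E d in {x | ∀ i, 0 ≤ x i}, ENNReal.ofReal (Real.exp (-∑ i, a i * x i)) =
      ∏ i, expHalfLine (a i) := by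
  have hmeas : MeasurableSet {x : E d | ∀ i, 0 ≤ x i} := by
    rw [Set.ofPred_forall]
    exact MeasurableSet.iInter fun i => measurableSet_le measurable_const (by fun_prop)
  have hf : ∀ i, Measurable ((Set.Ici (0 : ℝ)).indicator
      fun t => ENNReal.ofReal (Real.exp (-(a i * t)))) := fun i =>
    Measurable.indicator (by fun_prop) measurableSet_Ici
  simp only [expHalfLine, ← lintegral_indicator measurableSet_Ici]
  rw [← lintegral_pi_prod hf, ← lintegral_indicator hmeas,
    ← (PiLp.volume_preserving_toLp (Fin d)).lintegral_comp_emb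
      (MeasurableEquiv.toLp 2 (Fin d → ℝ)).measurableEmbedding]
  refine lintegral_congr fun x => ?_
  by_cases hx : ∀ i, 0 ≤ x i
  · rw [Set.indicator_of_mem (by exact hx), ← Finset.sum_neg_distrib, Real.exp_sum,
      ENNReal.ofReal_prod_of_nonneg fun i _ => (Real.exp_pos _).le]
    exact Finset.prod_congr rfl fun i _ => by rw [Set.indicator_of_mem (by exact hx i)]
  · rw [Set.indicator_of_notMem (by exact hx)]
    push Not at hx
    obtain ⟨i, hi⟩ := hx
    rw [Finset.prod_eq_zero (Finset.mem_univ i)]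
    exact Set.indicator_of_notMem (by exact not_le.2 hi) _

section SimplicialCone

variable {g : ℕ} {gen : Fin g → E d} {s : Finset (Fin g)}

/-- The linear map that sends the standard basis to the generators of a simplicial cone. -/
def genMap (gen : Fin g → E d) (s : Finset (Fin g)) (hs : s.card = d) : E d →ₗ[ℝ] E d :=
  Matrix.toLpLin 2 2 (Matrix.of fun i j : Fin d => gen (s.orderEmbOfFin hs i) j).transpose

theorem abs_det_genMap (hs : s.card = d) : |LinearMap.det (genMap gen s hs)| = absDet gen s hs := by
  rw [genMap, Matrix.toLpLin_eq_toLin, LinearMap.det_toLin, Matrix.det_transpose, absDet]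

theorem genMap_apply (hs : s.card = d) (x : E d) :
    genMap gen s hs x = ∑ j, x j • gen (s.orderEmbOfFin hs j) := by
  ext i
  simp [genMap, Matrix.toLpLin_apply, Matrix.mulVec, dotProduct, mul_comm]

theorem sum_orderEmbOfFin {M : Type*} [AddCommMonoid M] (hs : s.card = d) (f : Fin g → M) :
    ∑ j, f (s.orderEmbOfFin hs j) = ∑ i ∈ s, f i := by
  rw [← Finset.sum_coe_sort s, ← (s.orderIsoOfFin hs).toEquiv.sum_comp]
  rfl

theorem prod_orderEmbOfFin {M : Type*} [CommMonoid M] (hs : s.card = d) (f : Fin g → M) :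
    ∏ j, f (s.orderEmbOfFin hs j) = ∏ i ∈ s, f i := by
  rw [← Finset.prod_coe_sort s, ← (s.orderIsoOfFin hs).toEquiv.prod_comp]
  rfl

theorem IsBasisSet.card_eq (h : IsBasisSet gen s) : s.card = d := h.1

theorem IsBasisSet.linearIndependent (h : IsBasisSet gen s) :
    LinearIndependent ℝ fun i : s => gen i := h.2

theorem IsBasisSet.genMap_injective (h : IsBasisSet gen s) :
    Function.Injective (genMap gen s h.card_eq) := by
  rw [← LinearMap.ker_eq_bot, LinearMap.ker_eq_bot']
  intro x hx
  have hli : LinearIndependent ℝ (fun j => gen (s.orderEmbOfFin h.card_eq j)) :=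
    LinearIndependent.comp h.linearIndependent (s.orderIsoOfFin h.card_eq)
      (s.orderIsoOfFin h.card_eq).injective
  rw [genMap_apply] at hx
  ext i
  exact Fintype.linearIndependent_iff.1 hli _ hx i

theorem IsBasisSet.absDet_pos (h : IsBasisSet gen s) : 0 < absDet gen s h.card_eq := by
  rw [← abs_det_genMap, abs_pos]
  intro h0
  have := LinearMap.bot_lt_ker_of_det_eq_zero h0
  rw [LinearMap.ker_eq_bot.2 h.genMap_injective] at this
  exact lt_irrefl _ this

theorem genMap_image_orthant (hs : s.card = d) :
    genMap gen s hs '' {x | ∀ i, 0 ≤ x i} = simplexCone gen s := by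
  ext y
  constructor
  · rintro ⟨x, hx, rfl⟩
    refine ⟨fun i => if hi : i ∈ s then x ((s.orderIsoOfFin hs).symm ⟨i, hi⟩) else 0,
      fun i => ?_, ?_⟩
    · dsimp only
      split_ifs
      · exact hx _
      · exact le_rfl
    · rw [← sum_orderEmbOfFin hs, genMap_apply]
      refine Finset.sum_congr rfl fun j _ => ?_
      dsimp only
      rw [dif_pos (s.orderEmbOfFin_mem hs j)]
      have hj : (s.orderIsoOfFin hs).symm ⟨_, s.orderEmbOfFin_mem hs j⟩ = j := by
        rw [OrderIso.symm_apply_eq]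
        rfl
      rw [hj]
  · rintro ⟨c, hc, rfl⟩
    refine ⟨WithLp.toLp 2 fun j => c (s.orderEmbOfFin hs j), fun j => hc _, ?_⟩
    rw [genMap_apply, ← sum_orderEmbOfFin hs]

/-- The cone is the image of the orthant under `genMap`, whose Jacobian is `absDet`; over the
orthant the integral factors. -/
theorem IsBasisSet.setLIntegral_simplexCone (h : IsBasisSet gen s) (p : E d) :
    ∫⁻ v in simplexCone gen s, ENNReal.ofReal (Real.exp (-⟪v, p⟫)) =
      ENNReal.ofReal (absDet gen s h.card_eq) * ∏ i ∈ s, expHalfLine ⟪gen i, p⟫ := by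
  have hmeas : MeasurableSet {x : E d | ∀ i, 0 ≤ x i} := by
    rw [Set.ofPred_forall]
    exact MeasurableSet.iInter fun i => measurableSet_le measurable_const (by fun_prop)
  rw [← genMap_image_orthant h.card_eq]
  rw [lintegral_image_eq_lintegral_abs_det_fderiv_mul volume hmeas
    (f := genMap gen s h.card_eq) (f' := fun _ => (genMap gen s h.card_eq).toContinuousLinearMap)
    (fun x _ => (genMap gen s h.card_eq).toContinuousLinearMap.hasFDerivWithinAt)
    (h.genMap_injective.injOn)]
  have hdet : |((genMap gen s h.card_eq).toContinuousLinearMap).det| = absDet gen s h.card_eq :=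
    abs_det_genMap h.card_eq
  rw [hdet, lintegral_const_mul' _ _ ENNReal.ofReal_ne_top]
  congr 1
  rw [← prod_orderEmbOfFin h.card_eq fun i => expHalfLine ⟪gen i, p⟫, ← setLIntegral_orthant]
  refine lintegral_congr fun x => ?_
  rw [genMap_apply, sum_inner]
  simp only [inner_smul_left, conj_trivial, mul_comm]

end SimplicialCone

/-! ### The integrand -/

theorem measurable_supportFun (P : Set (E d)) : Measurable (supportFun P) := by
  refine LowerSemicontinuous.measurable (lowerSemicontinuous_biSup fun y _ => ?_)
  refine Continuous.lowerSemicontinuous ?_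
  exact continuous_coe_real_ereal.comp (by fun_prop)

/-- The integrand of the exponential integral. -/
def expDensity (P : Set (E d)) (z v : E d) : ℝ≥0∞ :=
  EReal.exp (-supportFun P v - ((⟪v, z⟫ : ℝ) : EReal))

theorem expDensity_eq_mul (P : Set (E d)) (z v : E d) :
    expDensity P z v = EReal.exp (-supportFun P v) * ENNReal.ofReal (Real.exp (-⟪v, z⟫)) := by
  rw [expDensity, sub_eq_add_neg, EReal.exp_add, ← EReal.coe_neg, EReal.exp_coe]

theorem measurable_expDensity (P : Set (E d)) (z : E d) : Measurable (expDensity P z) := by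
  have h : expDensity P z = fun v =>
      EReal.exp (-supportFun P v) * ENNReal.ofReal (Real.exp (-⟪v, z⟫)) :=
    funext (expDensity_eq_mul P z)
  rw [h]
  exact (EReal.measurable_exp.comp (measurable_supportFun P).neg).mul (by fun_prop)

theorem expDensity_eq_zero_iff {P : Set (E d)} {z v : E d} :
    expDensity P z v = 0 ↔ supportFun P v = ⊤ := by
  rw [expDensity_eq_mul, mul_eq_zero, EReal.exp_eq_zero_iff, EReal.neg_eq_bot_iff, or_iff_left]
  exact (ENNReal.ofReal_pos.2 (Real.exp_pos _)).ne'

theorem expDensity_of_eq_coe {P : Set (E d)} {v y : E d} (z : E d)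
    (h : supportFun P v = ((-⟪v, y⟫ : ℝ) : EReal)) :
    expDensity P z v = ENNReal.ofReal (Real.exp (-⟪v, z - y⟫)) := by
  rw [expDensity, h, ← EReal.coe_neg, ← EReal.coe_sub, EReal.exp_coe, inner_sub_right]
  congr 2
  ring

/-- If the support function is infinite almost everywhere, all the integrals vanish. -/
theorem hasRegularizedIntegral_zero_of_ae_eq_top {P : Set (E d)}
    (h : ∀ᵐ v, supportFun P v = ⊤) (z : E d) : HasRegularizedIntegral P z 0 := by
  have h0 : ∀ w, expIntegral P w = 0 := fun w =>
    (lintegral_eq_zero_iff (measurable_expDensity P w)).2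
      (h.mono fun v hv => expDensity_eq_zero_iff.2 hv)
  have huniv : convergenceSet P = Set.univ := Set.eq_univ_of_forall fun w => by
    change expIntegral P w ≠ ⊤
    rw [h0 w]
    exact ENNReal.zero_ne_top
  refine Or.inl ⟨by rw [huniv, interior_univ]; exact Set.univ_nonempty, 0, 1, fun w _ => ?_, ?_, ?_⟩
  · simp [h0 w]
  · simp
  · simp

/-- A function on which the translations in some direction act by positive scalars `exp (k t)`
cannot have a finite nonzero integral. -/
theorem lintegral_eq_zero_of_forall_add_smul {f : E d → ℝ≥0∞} {u : E d} (hu : u ≠ 0) {k : ℝ}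
    (hf : ∀ v (t : ℝ), f (v + t • u) = ENNReal.ofReal (Real.exp (k * t)) * f v)
    (hfin : ∫⁻ v, f v ≠ ⊤) : ∫⁻ v, f v = 0 := by
  wlog hk : 0 ≤ k generalizing u k
  · refine this (neg_ne_zero.2 hu) (k := -k) (fun v t => ?_) (by linarith)
    rw [smul_neg, ← neg_smul, hf, neg_mul, mul_neg]
  set q := ⟪u, u⟫ with hq
  have hqpos : 0 < q := real_inner_self_pos.2 hu
  -- Slabs of width `‖u‖`. Translation by `u` moves each to the next and does not decrease the
  -- integral, so a nonzero integral over one slab would make the total infinite.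
  let S : ℤ → Set (E d) := fun n => {v | ⌊⟪v, u⟫ / q⌋ = n}
  have hS : ∀ n, MeasurableSet (S n) := fun n => by
    have h1 : Measurable fun v : E d => ⌊⟪v, u⟫ / q⌋ :=
      Int.measurable_floor.comp (by fun_prop)
    exact h1 (measurableSet_singleton n)
  have hdisj : Pairwise (Function.onFun Disjoint S) := fun m n hmn =>
    Set.disjoint_left.2 fun v hm hn => hmn (hm.symm.trans hn)
  have hshift : ∀ (m : ℤ) (j : ℕ), ∫⁻ v in S m, f v ≤ ∫⁻ v in S (m + j), f v := by
    intro m j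
    rw [← lintegral_indicator (hS _), ← lintegral_indicator (hS _),
      ← lintegral_add_right_eq_self ((S (m + j)).indicator f) ((j : ℝ) • u)]
    refine lintegral_mono fun v => ?_
    by_cases hv : v ∈ S m
    · have hv' : v + (j : ℝ) • u ∈ S (m + j) := by
        change ⌊⟪v + (j : ℝ) • u, u⟫ / q⌋ = m + j
        rw [inner_add_left, inner_smul_left, ← hq, add_div, conj_trivial,
          mul_div_cancel_right₀ _ hqpos.ne', Int.floor_add_natCast]
        rw [show ⌊⟪v, u⟫ / q⌋ = m from hv]
      rw [Set.indicator_of_mem hv, Set.indicator_of_mem hv', hf]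
      refine le_mul_of_one_le_left (zero_le) ?_
      rw [ENNReal.one_le_ofReal, Real.one_le_exp_iff]
      positivity
    · rw [Set.indicator_of_notMem hv]
      exact zero_le
  have hzero : ∀ m, ∫⁻ v in S m, f v = 0 := by
    intro m
    by_contra hne
    have h1 : ∑' _ : ℕ, ∫⁻ v in S m, f v ≤ ∫⁻ v, f v := by
      refine (ENNReal.tsum_le_tsum fun j => hshift m j).trans ?_
      rw [← lintegral_iUnion (fun j : ℕ => hS (m + j))]
      · exact setLIntegral_le_lintegral _ _
      · exact fun i j hij => hdisj fun h => hij (by exact_mod_cast add_left_cancel h)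
    rw [ENNReal.tsum_const_eq_top_of_ne_zero hne, top_le_iff] at h1
    exact hfin h1
  have huniv : (⋃ n, S n) = Set.univ :=
    Set.eq_univ_of_forall fun v => Set.mem_iUnion.2 ⟨_, rfl⟩
  rw [← setLIntegral_univ, ← huniv, lintegral_iUnion hS hdisj]
  simp [hzero]

theorem supportFun_add_smul_le {P : Set (E d)} {u : E d} {c : ℝ} (hu : ∀ x ∈ P, ⟪u, x⟫ = c)
    (v : E d) (t : ℝ) : supportFun P (v + t • u) ≤ supportFun P v + ((-(t * c) : ℝ) : EReal) := by
  refine iSup₂_le fun x hx => ?_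
  refine le_trans (le_of_eq ?_) (add_le_add_left (neg_inner_le_supportFun hx) _)
  rw [← EReal.coe_add, inner_add_left, inner_smul_left, hu x hx, conj_trivial]
  congr 1
  ring

theorem expDensity_add_smul {P : Set (E d)} {u : E d} {c : ℝ} (hu : ∀ x ∈ P, ⟪u, x⟫ = c)
    (z v : E d) (t : ℝ) : expDensity P z (v + t • u) =
      ENNReal.ofReal (Real.exp ((c - ⟪u, z⟫) * t)) * expDensity P z v := by
  have hs : supportFun P (v + t • u) = supportFun P v + ((-(t * c) : ℝ) : EReal) := by
    refine le_antisymm (supportFun_add_smul_le hu v t) ?_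
    have h1 := supportFun_add_smul_le hu (v + t • u) (-t)
    rw [neg_smul, add_neg_cancel_right, neg_mul, neg_neg] at h1
    refine (add_le_add_left h1 _).trans (le_of_eq ?_)
    rw [add_assoc, ← EReal.coe_add, add_neg_cancel, EReal.coe_zero, add_zero]
  rw [expDensity_eq_mul, expDensity_eq_mul, hs,
    EReal.neg_add (Or.inr (EReal.coe_ne_top _)) (Or.inr (EReal.coe_ne_bot _)), sub_eq_add_neg,
    EReal.exp_add, ← EReal.coe_neg, EReal.exp_coe, mul_assoc,
    ← ENNReal.ofReal_mul (Real.exp_pos _).le, ← Real.exp_add, mul_left_comm,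
    ← ENNReal.ofReal_mul (Real.exp_pos _).le, ← Real.exp_add]
  congr 3
  rw [inner_add_left, inner_smul_left, conj_trivial]
  ring

/-- The integrals of a polyhedron that is not full-dimensional are all zero or all infinite. -/
theorem hasRegularizedIntegral_zero_of_affineSpan_ne_top {P : Set (E d)} (hne : P.Nonempty)
    (htop : affineSpan ℝ P ≠ ⊤) (z : E d) : HasRegularizedIntegral P z 0 := by
  have h1 : (vectorSpan ℝ P)ᗮ ≠ ⊥ := fun h =>
    htop ((AffineSubspace.affineSpan_eq_top_iff_vectorSpan_eq_top_of_nonempty ℝ _ _ hne).2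
      (Submodule.orthogonal_eq_bot_iff.1 h))
  obtain ⟨u, hu, hu0⟩ := Submodule.exists_mem_ne_zero_of_ne_bot h1
  obtain ⟨x₀, hx₀⟩ := hne
  have hc : ∀ x ∈ P, ⟪u, x⟫ = ⟪u, x₀⟫ := by
    intro x hx
    have := (Submodule.mem_orthogonal' _ _).1 hu _ (vsub_mem_vectorSpan ℝ hx hx₀)
    rw [vsub_eq_sub, inner_sub_right] at this
    linarith
  by_cases hconv : convergenceSet P = ∅
  · exact Or.inr ⟨hconv, rfl⟩
  · obtain ⟨w, hw⟩ := Set.nonempty_iff_ne_empty.2 hconv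
    have h0 := lintegral_eq_zero_of_forall_add_smul hu0 (expDensity_add_smul hc w) hw
    rw [lintegral_eq_zero_iff (measurable_expDensity P w)] at h0
    exact hasRegularizedIntegral_zero_of_ae_eq_top
      (h0.mono fun v hv => expDensity_eq_zero_iff.1 hv) z

/-! ### Convergence at interior points -/

theorem lintegral_exp_neg_mul_norm_ne_top {ε : ℝ} (hε : 0 < ε) :
    ∫⁻ v : E d, ENNReal.ofReal (Real.exp (-(ε * ‖v‖))) ≠ ⊤ := by
  have hint : Integrable (fun v : E d => (1 + ‖v‖) ^ (-((d + 1 : ℕ) : ℝ))) :=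
    integrable_one_add_norm (by rw [finrank_euclideanSpace_fin]; push_cast; linarith)
  -- From `(ε(1+‖v‖))^(d+1) / (d+1)! ≤ exp(ε(1+‖v‖))`; the exponent `d + 1` exceeds the dimension,
  -- which gives integrability.
  set C := Real.exp ε * ((d + 1).factorial / ε ^ (d + 1)) with hC
  refine ne_top_of_le_ne_top (hint.const_mul C).lintegral_lt_top.ne
    (lintegral_mono fun v => ENNReal.ofReal_le_ofReal ?_)
  have hv : 0 < 1 + ‖v‖ := by positivity
  have h1 := Real.pow_div_factorial_le_exp (ε * (1 + ‖v‖)) (by positivity) (d + 1)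
  rw [Real.rpow_neg hv.le, Real.rpow_natCast, hC]
  have h2 : -(ε * ‖v‖) = ε - ε * (1 + ‖v‖) := by ring
  rw [h2, Real.exp_sub, div_eq_mul_inv, mul_assoc]
  refine mul_le_mul_of_nonneg_left ?_ (Real.exp_pos _).le
  rw [← inv_div, ← mul_inv]
  refine inv_anti₀ (by positivity) (le_trans (le_of_eq ?_) h1)
  rw [mul_pow]
  ring

theorem expIntegral_ne_top_of_mem_interior {P : Set (E d)} {z : E d} (hz : z ∈ interior P) :
    expIntegral P z ≠ ⊤ := by
  obtain ⟨ε, hε, hball⟩ := Metric.nhds_basis_closedBall.mem_iff.1 (mem_interior_iff_mem_nhds.1 hz)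
  refine ne_top_of_le_ne_top (lintegral_exp_neg_mul_norm_ne_top hε)
    (lintegral_mono fun v => ?_)
  change expDensity P z v ≤ _
  -- Testing `h_P` at this point gives `h_P(v) + ⟪v, z⟫ ≥ ε‖v‖`. For `v = 0` the point is `z`
  -- itself.
  have hmem : z - (ε / ‖v‖) • v ∈ P := by
    refine hball ?_
    rw [Metric.mem_closedBall, dist_eq_norm, sub_sub_cancel_left, norm_neg, norm_smul,
      Real.norm_of_nonneg (by positivity)]
    rcases eq_or_ne ‖v‖ 0 with h0 | h0
    · rw [h0, mul_zero]
      exact hε.le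
    · rw [div_mul_cancel₀ _ h0]
  have hin : ⟪v, z - (ε / ‖v‖) • v⟫ = ⟪v, z⟫ - ε * ‖v‖ := by
    rw [inner_sub_right, inner_smul_right, real_inner_self_eq_norm_mul_norm]
    rcases eq_or_ne ‖v‖ 0 with h0 | h0
    · simp [h0]
    · field_simp
  have h1 := neg_inner_le_supportFun (v := v) hmem
  rw [hin] at h1
  have h2 : EReal.exp (-supportFun P v) ≤ ENNReal.ofReal (Real.exp (⟪v, z⟫ - ε * ‖v‖)) := by
    rw [← EReal.exp_coe, EReal.exp_le_exp_iff, EReal.neg_le, ← EReal.coe_neg]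
    exact h1
  rw [expDensity_eq_mul]
  refine (mul_le_mul_left h2 _).trans (le_of_eq ?_)
  rw [← ENNReal.ofReal_mul (Real.exp_pos _).le, ← Real.exp_add]
  congr 2
  ring

/-! ### The dual volume as an integral -/

section Triangulation

variable {P : Set (E d)}

theorem FanTriangulation.isBasisSet {𝓕 : Set (Set (E d))} (T : FanTriangulation 𝓕)
    (s : T.simplices) : IsBasisSet T.gen s.1 :=
  ⟨T.card_eq s.1 s.2, T.linearIndependent s.1 s.2⟩

/-- Distinct simplices share fewer than `d` generators, so their cones meet inside a proper
subspace. -/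
theorem FanTriangulation.aedisjoint {𝓕 : Set (Set (E d))} (T : FanTriangulation 𝓕)
    {s t : T.simplices} (hst : s ≠ t) :
    AEDisjoint volume (simplexCone T.gen s.1) (simplexCone T.gen t.1) := by
  rw [AEDisjoint, T.inter_eq s.1 s.2 t.1 t.2]
  refine measure_mono_null (simplexCone_subset_span _) (volume_span_image_eq_zero ?_)
  refine (Finset.card_lt_card ?_).trans_eq (T.card_eq s.1 s.2)
  refine (Finset.inter_subset_left.ssubset_of_ne fun h => hst ?_)
  refine Subtype.ext (Finset.eq_of_subset_of_card_le (Finset.inter_eq_left.1 h) ?_)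
  rw [T.card_eq s.1 s.2, T.card_eq t.1 t.2]

/-- The value `h_P(v) + ⟪v, z⟫` of the support function of `P - z`, as a real number. -/
def shiftedSupport (P : Set (E d)) (z v : E d) : ℝ := (supportFun P v).toReal + ⟪v, z⟫

theorem toReal_supportFun_translate {v : E d} (hv : v ∈ ⋃₀ normalFan P) (z : E d) :
    (supportFun (translate P z) v).toReal = shiftedSupport P z v := by
  obtain ⟨_, ⟨F, hF, rfl⟩, hvF⟩ := hv
  obtain ⟨y, hy⟩ := hF.2
  rw [supportFun_translate, shiftedSupport, hvF y hy, ← EReal.coe_add, EReal.toReal_coe,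
    EReal.toReal_coe]

theorem FanTriangulation.gen_mem (T : FanTriangulation (normalFan P)) (i : Fin T.g) :
    T.gen i ∈ ⋃₀ normalFan P :=
  ⟨_, T.gen_ray i, mem_ray_self _⟩

/-- The cone lies in the normal cone of one face, so `h_P(v) = -⟪v, y⟫` on it for any `y` in that
face. -/
theorem FanTriangulation.setLIntegral_expDensity (T : FanTriangulation (normalFan P)) (z : E d)
    (s : T.simplices) : ∫⁻ v in simplexCone T.gen s.1, expDensity P z v =
      ENNReal.ofReal (absDet T.gen s.1 (T.card_eq s.1 s.2)) *
        ∏ i ∈ s.1, expHalfLine (shiftedSupport P z (T.gen i)) := by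
  obtain ⟨_, ⟨F, hF, rfl⟩, hsub⟩ := T.subordinate s.1 s.2
  obtain ⟨y, hy⟩ := hF.2
  rw [setLIntegral_congr_fun (T.isBasisSet s).isClosed_simplexCone.measurableSet
    (fun v hv => expDensity_of_eq_coe z (hsub hv y hy)),
    (T.isBasisSet s).setLIntegral_simplexCone]
  congr 1
  refine Finset.prod_congr rfl fun i hi => ?_
  rw [shiftedSupport, hsub (mem_simplexCone_of_mem hi) y hy, EReal.toReal_coe, inner_sub_right]
  congr 1
  ring

theorem FanTriangulation.expIntegral_eq (T : FanTriangulation (normalFan P))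
    (hP : ∀ v, supportFun P v ≠ ⊤ → v ∈ ⋃₀ normalFan P) (z : E d) :
    expIntegral P z = ∑ s : T.simplices,
      ENNReal.ofReal (absDet T.gen s.1 (T.card_eq s.1 s.2)) *
        ∏ i ∈ s.1, expHalfLine (shiftedSupport P z (T.gen i)) := by
  have hsupp : (expDensity P z).support ⊆
      ⋃ s ∈ (Finset.univ : Finset T.simplices), simplexCone T.gen s.1 := by
    intro v hv
    have h1 := hP v fun h => hv (expDensity_eq_zero_iff.2 h)
    rw [← T.covers] at h1
    simpa using h1
  change ∫⁻ v, expDensity P z v = _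
  rw [← setLIntegral_eq_of_support_subset hsupp, lintegral_biUnion_finset₀
    (fun s _ t _ hst => T.aedisjoint hst)
    (fun s _ => (T.isBasisSet s).isClosed_simplexCone.measurableSet.nullMeasurableSet)]
  exact Finset.sum_congr rfl fun s _ => T.setLIntegral_expDensity z s

/-- Where the integral converges, the support function is positive on the generators of the
triangulation, and the sum of the triangulation is the integral. -/
theorem FanTriangulation.of_mem_convergenceSet (T : FanTriangulation (normalFan P))
    (hP : ∀ v, supportFun P v ≠ ⊤ → v ∈ ⋃₀ normalFan P) {z : E d} (hz : z ∈ convergenceSet P) :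
    (∀ s : T.simplices, ∀ i ∈ s.1, 0 < shiftedSupport P z (T.gen i)) ∧
      (expIntegral P z).toReal = T.sum (shiftedSupport P z) := by
  classical
  have hsum := T.expIntegral_eq hP z
  have hz' : expIntegral P z ≠ ⊤ := hz
  have hterm := ENNReal.sum_ne_top.1 (hsum ▸ hz')
  have hpos : ∀ s : T.simplices, ∀ i ∈ s.1, 0 < shiftedSupport P z (T.gen i) := by
    intro s i hi
    by_contra hneg
    refine hterm s (Finset.mem_univ s) ?_
    rw [← Finset.mul_prod_erase s.1 _ hi, expHalfLine_of_nonpos (not_lt.1 hneg),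
      ENNReal.top_mul (Finset.prod_ne_zero_iff.2 fun j _ => expHalfLine_ne_zero _),
      ENNReal.mul_top (ENNReal.ofReal_pos.2 (T.isBasisSet s).absDet_pos).ne']
  refine ⟨hpos, ?_⟩
  rw [hsum, ENNReal.toReal_sum hterm, FanTriangulation.sum]
  refine Finset.sum_congr rfl fun s _ => ?_
  rw [ENNReal.toReal_mul, ENNReal.toReal_ofReal (T.isBasisSet s).absDet_pos.le,
    ENNReal.toReal_prod, div_eq_mul_inv, ← Finset.prod_inv_distrib]
  congr 1
  refine Finset.prod_congr rfl fun i hi => ?_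
  rw [expHalfLine_of_pos (hpos s i hi), ENNReal.toReal_ofReal (inv_pos.2 (hpos s i hi)).le]

/-- `h_P(v) + ⟪v, z⟫` as a polynomial in the coordinates of `z`. -/
def supportPolynomial (P : Set (E d)) (v : E d) : MvPolynomial (Fin d) ℝ :=
  MvPolynomial.C (supportFun P v).toReal + ∑ k, MvPolynomial.C (v k) * MvPolynomial.X k

theorem eval_supportPolynomial (P : Set (E d)) (v z : E d) :
    MvPolynomial.eval (fun i => z i) (supportPolynomial P v) = shiftedSupport P z v := by
  simp [supportPolynomial, shiftedSupport, PiLp.inner_apply, mul_comm]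

open Classical in
/-- The numerator of the sum of a triangulation. -/
def FanTriangulation.numerator (T : FanTriangulation (normalFan P)) : MvPolynomial (Fin d) ℝ :=
  ∑ s : T.simplices, MvPolynomial.C (absDet T.gen s.1 (T.card_eq s.1 s.2)) *
    ∏ t ∈ Finset.univ.erase s, ∏ i ∈ t.1, supportPolynomial P (T.gen i)

/-- The denominator of the sum of a triangulation. -/
def FanTriangulation.denominator (T : FanTriangulation (normalFan P)) : MvPolynomial (Fin d) ℝ :=
  ∏ s : T.simplices, ∏ i ∈ s.1, supportPolynomial P (T.gen i)

theorem FanTriangulation.eval_denominator_ne_zero (T : FanTriangulation (normalFan P)) {z : E d}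
    (hz : ∀ s : T.simplices, ∀ i ∈ s.1, shiftedSupport P z (T.gen i) ≠ 0) :
    MvPolynomial.eval (fun i => z i) T.denominator ≠ 0 := by
  simp only [denominator, map_prod, eval_supportPolynomial]
  exact Finset.prod_ne_zero_iff.2 fun s _ => Finset.prod_ne_zero_iff.2 fun i hi => hz s i hi

theorem FanTriangulation.sum_eq_div (T : FanTriangulation (normalFan P)) {z : E d}
    (hz : ∀ s : T.simplices, ∀ i ∈ s.1, shiftedSupport P z (T.gen i) ≠ 0) :
    T.sum (shiftedSupport P z) = MvPolynomial.eval (fun i => z i) T.numerator /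
      MvPolynomial.eval (fun i => z i) T.denominator := by
  classical
  have h0 := T.eval_denominator_ne_zero hz
  simp only [denominator, numerator, map_prod, map_sum, map_mul, MvPolynomial.eval_C,
    eval_supportPolynomial, FanTriangulation.sum] at h0 ⊢
  rw [Finset.sum_div]
  refine Finset.sum_congr rfl fun s _ => ?_
  have hs : ∏ i ∈ s.1, shiftedSupport P z (T.gen i) ≠ 0 :=
    Finset.prod_ne_zero_iff.2 fun i hi => hz s i hi
  rw [div_eq_div_iff hs h0, ← Finset.mul_prod_erase Finset.univ
    (fun s : T.simplices => ∏ i ∈ s.1, shiftedSupport P z (T.gen i)) (Finset.mem_univ s)]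
  ring

/-- The sum of any triangulation is the regularized value of the integral. -/
theorem FanTriangulation.hasRegularizedIntegral (T : FanTriangulation (normalFan P))
    (hP : IsPolyhedron P) (hfin : ∀ v, supportFun P v ≠ ⊤ → v ∈ ⋃₀ normalFan P)
    (htop : affineSpan ℝ P = ⊤) {z : E d} (hz : NonCodegenerate (translate P z)) :
    HasRegularizedIntegral P z (T.sum (shiftedSupport P z)) := by
  have hne : ∀ s : T.simplices, ∀ i ∈ s.1, shiftedSupport P z (T.gen i) ≠ 0 := by
    intro s i _
    rw [← toReal_supportFun_translate (T.gen_mem i)]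
    refine hz.supportFun_ne_zero (hP.translate z) (affineSpan_translate_eq_top z htop)
      (T.gen_ne_zero i) ?_
    rw [normalFan_translate]
    exact T.gen_ray i
  have hint : (interior P).Nonempty := hP.convex.interior_nonempty_iff_affineSpan_eq_top.2 htop
  refine Or.inl ⟨?_, T.numerator, T.denominator, fun w hw => ?_, T.eval_denominator_ne_zero hne,
    T.sum_eq_div hne⟩
  · exact hint.mono (interior_maximal (fun w hw => expIntegral_ne_top_of_mem_interior hw)
      isOpen_interior)
  · obtain ⟨hpos, hsum⟩ := T.of_mem_convergenceSet hfin hw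
    have hw0 : ∀ s : T.simplices, ∀ i ∈ s.1, shiftedSupport P w (T.gen i) ≠ 0 :=
      fun s i hi => (hpos s i hi).ne'
    exact ⟨T.eval_denominator_ne_zero hw0, by rw [hsum, T.sum_eq_div hw0]⟩

end Triangulation

/-! ### Polyhedra with lines, and the conclusion -/

/-- If the normal vectors do not span, the support function is infinite almost everywhere, and
the normal fan has no triangulation. -/
theorem degenerate_of_span_ne_top {g : ℕ} {V : Fin g → E d} {h : Fin g → ℝ}
    (hne : (solutionSet V h).Nonempty) (hspan : Submodule.span ℝ (Set.range V) ≠ ⊤) :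
    (∀ᵐ v, supportFun (solutionSet V h) v = ⊤) ∧
      IsEmpty (FanTriangulation (normalFan (solutionSet V h))) := by
  obtain ⟨u, hu, hu0⟩ := Submodule.exists_mem_ne_zero_of_ne_bot
    (fun h => hspan (Submodule.orthogonal_eq_bot_iff.1 h))
  have hVu : ∀ i, ⟪V i, u⟫ = 0 := fun i =>
    (Submodule.mem_orthogonal _ _).1 hu _ (Submodule.subset_span ⟨i, rfl⟩)
  obtain ⟨x, hx⟩ := hne
  have hfin : ∀ v, supportFun (solutionSet V h) v ≠ ⊤ → v ∈ (Submodule.span ℝ {u})ᗮ := by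
    intro v hv
    rw [Submodule.mem_orthogonal_singleton_iff_inner_left]
    by_contra hvu
    refine hv ((EReal.eq_top_iff_forall_lt _).2 fun y => ?_)
    -- The polyhedron contains the line through `x` along `u`; at this point of it `-⟪v, ·⟫` equals
    -- `y + 1`.
    have hmem : x + (-(y + ⟪v, x⟫ + 1) / ⟪v, u⟫) • u ∈ solutionSet V h := fun i => by
      rw [inner_add_right, inner_smul_right, hVu, mul_zero, add_zero]
      exact hx i
    refine lt_of_lt_of_le (EReal.coe_lt_coe_iff.2 ?_) (neg_inner_le_supportFun hmem)
    rw [inner_add_right, inner_smul_right, div_mul_cancel₀ _ hvu]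
    linarith
  have hlt : Module.finrank ℝ (Submodule.span ℝ {u})ᗮ < d := by
    have := finrank_orthogonal_span_singleton_add_one hu0
    omega
  have hU : (Submodule.span ℝ {u})ᗮ ≠ ⊤ := fun htop => by
    rw [htop, finrank_top, finrank_euclideanSpace_fin] at hlt
    exact lt_irrefl _ hlt
  constructor
  · filter_upwards [measure_eq_zero_iff_ae_notMem.1
      (Measure.addHaar_submodule (volume : Measure (E d)) _ hU)] with v hv
    by_contra hvtop
    exact hv (hfin v hvtop)
  · refine ⟨fun T => hU ?_⟩
    -- The fan contains `0`, so a triangulation has at least one simplex; its generators would be a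
    -- basis inside the hyperplane orthogonal to `u`.
    have h0 : (0 : E d) ∈ ⋃ s ∈ T.simplices, simplexCone T.gen s := by
      rw [T.covers]
      exact ⟨_, ⟨_, ⟨fun _ => ⟨0, rfl⟩, x, by simpa using hx⟩, rfl⟩,
        (mem_normalCone_iff fun y hy => hy.1).2 fun y _ x _ => by simp⟩
    simp only [Set.mem_iUnion, exists_prop] at h0
    obtain ⟨s, hs, -⟩ := h0
    rw [eq_top_iff, ← (T.isBasisSet ⟨s, hs⟩).span_eq_top, Submodule.span_le]
    rintro _ ⟨i, -, rfl⟩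
    exact hfin _ (supportFun_ne_top_of_mem_sUnion (T.gen_mem i))

open Classical in
-- The fan, and with it the chosen triangulation, is the same for all `z`; only the support values
-- vary.
theorem dualVolumeAt_eq (P : Set (E d)) (z : E d) : dualVolumeAt P z =
    if affineSpan ℝ P = ⊤ then
      fanDualVolume (normalFan P) (fun v => (supportFun (translate P z) v).toReal) else 0 := by
  rw [dualVolumeAt, dualVolume, normalFan_translate]
  simp only [affineSpan_translate_eq_top_iff]

/-- The dual volume function is the regularized value of the integral. -/
theorem IsPolyhedron.hasRegularizedIntegral {P : Set (E d)} (hP : IsPolyhedron P) {z : E d}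
    (hz : NonCodegenerate (DualVol.translate P z)) :
    HasRegularizedIntegral P z (dualVolumeAt P z) := by
  rw [dualVolumeAt_eq]
  split_ifs with htop
  swap
  · exact hasRegularizedIntegral_zero_of_affineSpan_ne_top hP.1 htop z
  obtain ⟨g, V, h, hPV, hirr⟩ := hP.exists_solutionSet
  by_cases hspan : Submodule.span ℝ (Set.range V) = ⊤
  · have hint := hP.convex.interior_nonempty_iff_affineSpan_eq_top.2 htop
    obtain ⟨hpure, hT, hfin⟩ := hirr.exists_fanTriangulation (hPV ▸ hint) hspan
    rw [← hPV] at hpure hT hfin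
    rw [fanDualVolume, dif_pos ⟨hpure, hT⟩]
    -- The formula holds for every triangulation, so independence of the choice need not be proved
    -- separately.
    convert (Classical.choice hT).hasRegularizedIntegral hP hfin htop hz using 1
    refine Finset.sum_congr rfl fun s _ => ?_
    congr 1
    exact Finset.prod_congr rfl fun i _ =>
      toReal_supportFun_translate (FanTriangulation.gen_mem _ i) z
  · obtain ⟨hae, hempty⟩ := degenerate_of_span_ne_top (h := h) (hPV ▸ hP.1) hspan
    rw [← hPV] at hae hempty
    rw [fanDualVolume, dif_neg fun hT => not_isEmpty_iff.2 hT.2 hempty]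
    exact hasRegularizedIntegral_zero_of_ae_eq_top hae z

/-- Where the integral converges, its regularized value is its value. -/
theorem HasRegularizedIntegral.eq_toReal {P : Set (E d)} {z : E d} {x : ℝ}
    (hx : HasRegularizedIntegral P z x) (hz : expIntegral P z ≠ ⊤) :
    x = (expIntegral P z).toReal := by
  rcases hx with ⟨-, N, D, h, -, rfl⟩ | ⟨hempty, -⟩
  · exact (h z hz).2.symm
  · exact absurd (show z ∈ convergenceSet P from hz) (hempty ▸ Set.notMem_empty z)

theorem nonCodegenerate_translate_of_mem_interior {P : Set (E d)} {z : E d}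
    (hz : z ∈ interior P) : NonCodegenerate (translate P z) := by
  refine nonCodegenerate_of_mem_interior ?_
  have hopen : IsOpen ((fun x => x + z) ⁻¹' interior P) := isOpen_interior.preimage (by fun_prop)
  refine interior_maximal (fun x hx => ?_) hopen (by simpa using hz)
  exact mem_translate.2 (interior_subset hx)

end DualVol

end

theorem mainTheorem5 {d : ℕ} (P : Set (DualVol.E d)) (hP : DualVol.IsPolyhedron P) :
    (∀ z : DualVol.E d, DualVol.NonCodegenerate (DualVol.translate P z) →
      DualVol.HasRegularizedIntegral P z (DualVol.dualVolumeAt P z)) ∧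
    (∀ z : DualVol.E d, DualVol.NonCodegenerate (DualVol.translate P z) →
      (∫⁻ v, EReal.exp (-DualVol.supportFun P v - ((inner ℝ v z : ℝ) : EReal))) ≠ ⊤ →
        DualVol.dualVolumeAt P z =
          (∫⁻ v, EReal.exp (-DualVol.supportFun P v - ((inner ℝ v z : ℝ) : EReal))).toReal) ∧
    (∀ z ∈ interior P, DualVol.NonCodegenerate (DualVol.translate P z) ∧
      (∫⁻ v, EReal.exp (-DualVol.supportFun P v - ((inner ℝ v z : ℝ) : EReal))) ≠ ⊤) ∧
    (DualVol.NonCodegenerate P →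
      DualVol.HasRegularizedIntegral P 0 (DualVol.dualVolume P) ∧
      ((∫⁻ v, EReal.exp (-DualVol.supportFun P v)) ≠ ⊤ →
        DualVol.dualVolume P = (∫⁻ v, EReal.exp (-DualVol.supportFun P v)).toReal)) := by
  refine ⟨fun z hz => hP.hasRegularizedIntegral hz,
    fun z hz hfin => (hP.hasRegularizedIntegral hz).eq_toReal hfin,
    fun z hz => ⟨DualVol.nonCodegenerate_translate_of_mem_interior hz,
      DualVol.expIntegral_ne_top_of_mem_interior hz⟩, fun hP0 => ?_⟩
  have h := hP.hasRegularizedIntegral (z := 0) (by rwa [DualVol.translate_zero])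
  rw [DualVol.dualVolumeAt, DualVol.translate_zero] at h
  have h0 : DualVol.expIntegral P 0 = ∫⁻ v, EReal.exp (-DualVol.supportFun P v) := by
    simp [DualVol.expIntegral]
  exact ⟨h, fun hfin => h0 ▸ h.eq_toReal (h0 ▸ hfin)⟩
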